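/- Let $n,m\ge 0$ be integers, let $V=V_0\oplus V_1$ be a complex $\mathbb Z_2$-graded vector space with $\dim V_0=n$, $\dim V_1=2m$, equipped with the even supersymmetric bilinear form $(\,,\,)$ that is the standard symmetric form on $V_0$ and the standard symplectic form on $V_1$. Let $\mathfrak g=\mathfrak{gl}(n,2m)=\mathfrak{gl}(V)$, let $\theta$ be the involutive automorphism of $\mathfrak g$ determined by $(\theta(x)v,w)+(-1)^{p(x)p(v)}(v,xw)=0$ for homogeneous $x,v$, and let $\mathfrak k=\mathfrak{osp}(n,2m)=\{x\in\mathfrak g:\theta(x)=x\}$. Modules are $\mathbb Z_2$-graded, irreducibility refers to graded submodules, and isomorphisms are even. For a finite-dimensional $\mathfrak g$-module $U$, let $U^\theta$ be the same graded space with $x$ acting as $\theta(x)$; let $U^*$ be the dual module, $(xl)(u)=-(-1)^{p(x)p(l)}l(xu)$; and let $U^{\mathfrak k}$ be the space of $u\in U$ with $xu=0$ for all $x\in\mathfrak k$. Call $U$ spherical if $U^{\mathfrak k}\ne0$. Let $U(\mathfrak g)$ be the universal enveloping superalgebra, $Z(\mathfrak g)$ its centre, and $y\mapsto y^t$ its principal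 anti-automorphism ($y^t=-y$ for $y\in\mathfrak g$); $U(\mathfrak g)$ acts on $U(\mathfrak g)^*$ by $(yf)(x)=(-1)^{p(y)p(f)}f(y^tx)$. A functional $f\in U(\mathfrak g)^*$ is zonal if $f(xw)=f(wx)=0$ for all $x\in\mathfrak k$, $w\in U(\mathfrak g)$, and zonal spherical if it is zonal, nonzero, and an eigenvector of every $z\in Z(\mathfrak g)$. For $u\in U^{\mathfrak k}$, $l\in (U^*)^{\mathfrak k}$ put $\phi_{u,l}(x)=l(xu)$, $x\in U(\mathfrak g)$, and let $\mathcal Z(U)\subset U(\mathfrak g)^*$ be the linear span of these functions. Theorem. Let $U$ be an irreducible finite-dimensional $\mathfrak g$-module. Then: (1) $U^\theta\cong U^*$; (2) $\dim U^{\mathfrak k}\le 1$; (3) if $U$ is spherical, then $\dim\mathcal Z(U)=1$, the space $\mathcal Z(U)$ is spanned by a zonal spherical function, and $\phi_{u,l}$ is zonal spherical for all nonzero $u\in U^{\mathfrak k}$ and $l\in(U^*)^{\mathfrak k}$. Moreover (3) also holds if throughout $U^{\mathfrak k}$ and $(U^*)^{\mathfrak k}$ are replaced by their subspaces of vectors that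 are in addition fixed by $O(n)\subset OSP(n,2m)$, that is, fixed by $\exp(X)$ for all $X\in\mathfrak{gl}(n)\subset\mathfrak g$ with $\exp(X)\in O(n)$. -/

import Mathlib

open scoped Matrix

noncomputable section

namespace GLOsp

/-! ### Parities and signs -/

/-- The Koszul sign `(-1)^{ij}`. -/
def sgn (i j : ZMod 2) : ℂ := if i = 1 ∧ j = 1 then -1 else 1

theorem zmod_two_cases (i : ZMod 2) : i = 0 ∨ i = 1 := by
  revert i; decide

@[simp] theorem sgn_zero_left (j : ZMod 2) : sgn 0 j = 1 := by simp [sgn]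

@[simp] theorem sgn_zero_right (j : ZMod 2) : sgn j 0 = 1 := by simp [sgn]

@[simp] theorem sgn_one_one : sgn 1 1 = -1 := by simp [sgn]

/-! ### The Lie superalgebra `gl(n,2m)` -/

/-- Index set of the standard basis of `V = V₀ ⊕ V₁`, with `dim V₀ = n` and `dim V₁ = 2m`. -/
abbrev Idx (n m : ℕ) := Fin n ⊕ (Fin m ⊕ Fin m)

/-- Parity of a basis vector of `V`. -/
def idxPar {n m : ℕ} : Idx n m → ZMod 2 := Sum.elim (fun _ => 0) (fun _ => 1)

/-- The underlying vector space of `gl(n,2m)`. -/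
abbrev Gl (n m : ℕ) := Matrix (Idx n m) (Idx n m) ℂ

/-- The homogeneous component of parity `i` of `gl(n,2m)`. -/
def glGr (n m : ℕ) (i : ZMod 2) : Submodule ℂ (Gl n m) where
  carrier := {x | ∀ a b, idxPar a + idxPar b ≠ i → x a b = 0}
  add_mem' hx hy a b h := by simp [hx a b h, hy a b h]
  zero_mem' := by simp
  smul_mem' c x hx a b h := by simp [hx a b h]

/-- For `x` of parity `i` and `y` of parity `j` in an associative superalgebra (in particular in
the matrix superalgebra `gl(n,2m)`), the supercommutator `xy - (-1)^{ij} yx`. -/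
def sbracket {A : Type*} [Ring A] [Algebra ℂ A] (i j : ZMod 2) (x y : A) : A :=
  x * y - sgn i j • (y * x)

/-- Projection of `gl(n,2m)` to its component of parity `i`. -/
def glProj {n m : ℕ} (i : ZMod 2) : Gl n m →ₗ[ℂ] Gl n m where
  toFun x := Matrix.of fun a b => if idxPar a + idxPar b = i then x a b else 0
  map_add' x y := by ext a b; by_cases h : idxPar a + idxPar b = i <;> simp [h]
  map_smul' c x := by ext a b; by_cases h : idxPar a + idxPar b = i <;> simp [h]

theorem glProj_of_mem {n m : ℕ} {i : ZMod 2} {x : Gl n m} (hx : x ∈ glGr n m i) :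
    glProj i x = x := by
  ext a b
  by_cases h : idxPar a + idxPar b = i
  · simp [glProj, h]
  · simp [glProj, h, hx a b h]

theorem glProj_of_mem_ne {n m : ℕ} {i j : ZMod 2} (hij : i ≠ j) {x : Gl n m}
    (hx : x ∈ glGr n m i) : glProj j x = 0 := by
  ext a b
  by_cases h : idxPar a + idxPar b = j
  · simp [glProj, h, hx a b (fun h' => hij (h'.symm.trans h))]
  · simp [glProj, h]

theorem glProj_mem {n m : ℕ} (i : ZMod 2) (x : Gl n m) : glProj i x ∈ glGr n m i := by
  intro a b h
  simp [glProj, h]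

theorem mul_mem_glGr {n m : ℕ} {i j : ZMod 2} {x y : Gl n m} (hx : x ∈ glGr n m i)
    (hy : y ∈ glGr n m j) : x * y ∈ glGr n m (i + j) := by
  intro a b h
  rw [Matrix.mul_apply]
  refine Finset.sum_eq_zero fun c _ => ?_
  by_cases h1 : idxPar a + idxPar c = i
  · by_cases h2 : idxPar c + idxPar b = j
    · exfalso
      apply h
      rw [← h1, ← h2]
      generalize idxPar a = p
      generalize idxPar b = q
      generalize idxPar c = r
      revert p q r
      decide
    · simp [hy c b h2]
  · simp [hx a c h1]

theorem sbracket_mem_glGr {n m : ℕ} {i j : ZMod 2} {x y : Gl n m} (hx : x ∈ glGr n m i)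
    (hy : y ∈ glGr n m j) : sbracket i j x y ∈ glGr n m (i + j) := by
  refine Submodule.sub_mem _ (mul_mem_glGr hx hy) (Submodule.smul_mem _ _ ?_)
  rw [add_comm]
  exact mul_mem_glGr hy hx

theorem eq_blocks_of_even {n m : ℕ} {x : Gl n m} (hx : x ∈ glGr n m 0) :
    x = Matrix.fromBlocks x.toBlocks₁₁ 0 0 x.toBlocks₂₂ := by
  ext a b
  rcases a with a | a <;> rcases b with b | b <;>
    simp [Matrix.toBlocks₁₁, Matrix.toBlocks₂₂]
  · exact hx _ _ (by simp [idxPar])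
  · exact hx _ _ (by simp [idxPar])

theorem eq_blocks_of_odd {n m : ℕ} {x : Gl n m} (hx : x ∈ glGr n m 1) :
    x = Matrix.fromBlocks 0 x.toBlocks₁₂ x.toBlocks₂₁ 0 := by
  ext a b
  rcases a with a | a <;> rcases b with b | b <;>
    simp [Matrix.toBlocks₁₂, Matrix.toBlocks₂₁]
  · exact hx _ _ (by simp [idxPar])
  · exact hx _ _ (by simp only [idxPar, Sum.elim_inr]; decide)

/-! ### The form on `V`, the involution `θ` and `osp(n,2m)` -/

/-- The even supersymmetric form on `V`: the standard symmetric form on `V₀` and the standard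
symplectic form on `V₁`. -/
def form {n m : ℕ} (v w : Idx n m → ℂ) : ℂ :=
  v ⬝ᵥ (Matrix.fromBlocks 1 0 0 (Matrix.J (Fin m) ℂ) *ᵥ w)

/-- The involution `θ` in block form; `form_theta` is its defining relation. -/
def theta {n m : ℕ} : Gl n m →ₗ[ℂ] Gl n m where
  toFun x := Matrix.fromBlocks
    (-(x.toBlocks₁₁)ᵀ) (-((x.toBlocks₂₁)ᵀ * Matrix.J (Fin m) ℂ))
    (-(Matrix.J (Fin m) ℂ * (x.toBlocks₁₂)ᵀ))
    (Matrix.J (Fin m) ℂ * (x.toBlocks₂₂)ᵀ * Matrix.J (Fin m) ℂ)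
  map_add' x y := by
    have h11 : (x + y).toBlocks₁₁ = x.toBlocks₁₁ + y.toBlocks₁₁ := rfl
    have h12 : (x + y).toBlocks₁₂ = x.toBlocks₁₂ + y.toBlocks₁₂ := rfl
    have h21 : (x + y).toBlocks₂₁ = x.toBlocks₂₁ + y.toBlocks₂₁ := rfl
    have h22 : (x + y).toBlocks₂₂ = x.toBlocks₂₂ + y.toBlocks₂₂ := rfl
    rw [h11, h12, h21, h22, Matrix.fromBlocks_add]
    congr 1 <;> simp [Matrix.add_mul, Matrix.mul_add, add_comm]
  map_smul' c x := by
    have h11 : (c • x).toBlocks₁₁ = c • x.toBlocks₁₁ := rfl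
    have h12 : (c • x).toBlocks₁₂ = c • x.toBlocks₁₂ := rfl
    have h21 : (c • x).toBlocks₂₁ = c • x.toBlocks₂₁ := rfl
    have h22 : (c • x).toBlocks₂₂ = c • x.toBlocks₂₂ := rfl
    rw [h11, h12, h21, h22, RingHom.id_apply, Matrix.fromBlocks_smul]
    congr 1 <;> simp

theorem theta_fromBlocks {n m : ℕ} (A : Matrix (Fin n) (Fin n) ℂ) (B C D) :
    theta (n := n) (m := m) (Matrix.fromBlocks A B C D) = Matrix.fromBlocks
      (-Aᵀ) (-(Cᵀ * Matrix.J (Fin m) ℂ)) (-(Matrix.J (Fin m) ℂ * Bᵀ))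
      (Matrix.J (Fin m) ℂ * Dᵀ * Matrix.J (Fin m) ℂ) := rfl

theorem J_mul_J_mul {m : ℕ} {ι : Type*} (A : Matrix (Fin m ⊕ Fin m) ι ℂ) :
    Matrix.J (Fin m) ℂ * (Matrix.J (Fin m) ℂ * A) = -A := by
  rw [← Matrix.mul_assoc, Matrix.J_squared]; simp

/-- A vector of `V` has parity `j`. -/
def VHom {n m : ℕ} (j : ZMod 2) (v : Idx n m → ℂ) : Prop := ∀ a, idxPar a ≠ j → v a = 0

/-- The defining relation `(θ(x)v, w) + (-1)^{p(x)p(v)} (v, xw) = 0` of `θ`. -/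
theorem form_theta {n m : ℕ} (i j : ZMod 2) (x : Gl n m) (hx : x ∈ glGr n m i)
    (v w : Idx n m → ℂ) (hv : VHom j v) :
    form (theta x *ᵥ v) w + sgn i j * form v (x *ᵥ w) = 0 := by
  have hform : ∀ A : Gl n m, form (A *ᵥ v) w =
      v ⬝ᵥ ((Aᵀ * Matrix.fromBlocks 1 0 0 (Matrix.J (Fin m) ℂ)) *ᵥ w) := by
    intro A
    rw [form, ← Matrix.mulVec_mulVec, Matrix.dotProduct_mulVec v, Matrix.vecMul_transpose]
  have hform' : form v (x *ᵥ w) =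
      v ⬝ᵥ ((Matrix.fromBlocks 1 0 0 (Matrix.J (Fin m) ℂ) * x) *ᵥ w) := by
    rw [form, Matrix.mulVec_mulVec]
  rw [hform, hform']
  rcases zmod_two_cases i with rfl | rfl
  · rw [eq_blocks_of_even hx, theta_fromBlocks]
    simp [Matrix.fromBlocks_transpose, Matrix.fromBlocks_multiply, Matrix.transpose_mul,
      Matrix.mul_assoc, Matrix.J_squared, Matrix.J_transpose]
    rw [← dotProduct_add, ← Matrix.add_mulVec, Matrix.fromBlocks_add]
    simp
  · rw [eq_blocks_of_odd hx, theta_fromBlocks]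
    have hw : w = Sum.elim (w ∘ Sum.inl) (w ∘ Sum.inr) := by
      ext a; rcases a with a | a <;> rfl
    have hv' : v = Sum.elim (v ∘ Sum.inl) (v ∘ Sum.inr) := by
      ext a; rcases a with a | a <;> rfl
    rcases zmod_two_cases j with rfl | rfl
    · have h0 : v ∘ Sum.inr = 0 := by
        ext a; exact hv (Sum.inr a) (by simp [idxPar])
      rw [h0] at hv'
      rw [hw, hv']
      simp [Matrix.fromBlocks_transpose, Matrix.fromBlocks_multiply, Matrix.transpose_mul,
        Matrix.mul_assoc, Matrix.J_squared, Matrix.J_transpose, Matrix.fromBlocks_mulVec,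
        Matrix.neg_mulVec]
    · have h0 : v ∘ Sum.inl = 0 := by
        ext a; exact hv (Sum.inl a) (by simp [idxPar])
      rw [h0] at hv'
      rw [hw, hv']
      simp [Matrix.fromBlocks_transpose, Matrix.fromBlocks_multiply, Matrix.transpose_mul,
        Matrix.mul_assoc, Matrix.J_squared, Matrix.J_transpose, Matrix.fromBlocks_mulVec,
        Matrix.neg_mulVec]

theorem theta_theta {n m : ℕ} (x : Gl n m) : theta (theta x) = x := by
  rw [← Matrix.fromBlocks_toBlocks x, theta_fromBlocks, theta_fromBlocks]
  simp [Matrix.transpose_mul, Matrix.mul_assoc, Matrix.J_transpose, J_mul_J_mul, Matrix.J_squared]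

theorem theta_mem {n m : ℕ} {i : ZMod 2} {x : Gl n m} (hx : x ∈ glGr n m i) :
    theta x ∈ glGr n m i := by
  rcases zmod_two_cases i with rfl | rfl
  · rw [eq_blocks_of_even hx, theta_fromBlocks]
    intro a b h
    rcases a with a | a <;> rcases b with b | b <;> simp [idxPar] at h ⊢
    exact absurd (by decide) h
  · rw [eq_blocks_of_odd hx, theta_fromBlocks]
    intro a b h
    rcases a with a | a <;> rcases b with b | b <;> simp [idxPar] at h ⊢

theorem theta_sbracket {n m : ℕ} {i j : ZMod 2} {x y : Gl n m} (hx : x ∈ glGr n m i)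
    (hy : y ∈ glGr n m j) :
    theta (sbracket i j x y) = sbracket i j (theta x) (theta y) := by
  rcases zmod_two_cases i with rfl | rfl <;> rcases zmod_two_cases j with rfl | rfl
  · rw [eq_blocks_of_even hx, eq_blocks_of_even hy]
    simp [sbracket, theta_fromBlocks, Matrix.fromBlocks_multiply, sub_eq_add_neg,
      Matrix.fromBlocks_neg, Matrix.fromBlocks_add,
      Matrix.transpose_mul, Matrix.mul_assoc, J_mul_J_mul, Matrix.mul_add, Matrix.add_mul, add_comm]
  · rw [eq_blocks_of_even hx, eq_blocks_of_odd hy]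
    simp [sbracket, theta_fromBlocks, Matrix.fromBlocks_multiply, sub_eq_add_neg,
      Matrix.fromBlocks_neg, Matrix.fromBlocks_add,
      Matrix.transpose_mul, Matrix.mul_assoc, J_mul_J_mul, Matrix.mul_add, Matrix.add_mul, add_comm]
  · rw [eq_blocks_of_odd hx, eq_blocks_of_even hy]
    simp [sbracket, theta_fromBlocks, Matrix.fromBlocks_multiply, sub_eq_add_neg,
      Matrix.fromBlocks_neg, Matrix.fromBlocks_add,
      Matrix.transpose_mul, Matrix.mul_assoc, J_mul_J_mul, Matrix.mul_add, Matrix.add_mul, add_comm]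
  · rw [eq_blocks_of_odd hx, eq_blocks_of_odd hy]
    simp [sbracket, theta_fromBlocks, Matrix.fromBlocks_multiply, sub_eq_add_neg,
      Matrix.fromBlocks_neg, Matrix.fromBlocks_add,
      Matrix.transpose_mul, Matrix.mul_assoc, J_mul_J_mul, Matrix.mul_add, Matrix.add_mul, add_comm]

/-- `osp(n,2m)`, the fixed points of `θ`. -/
def osp (n m : ℕ) : Submodule ℂ (Gl n m) where
  carrier := {x | theta x = x}
  add_mem' {x y} hx hy := by
    simp only [Set.mem_ofPred_eq] at hx hy ⊢
    rw [map_add, hx, hy]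
  zero_mem' := by simp
  smul_mem' c x hx := by
    simp only [Set.mem_ofPred_eq] at hx ⊢
    rw [map_smul, hx]

/-! ### The universal enveloping superalgebra -/

/-- The defining relations `xy - (-1)^{p(x)p(y)} yx = [x,y]` of `U(gl(n,2m))`. -/
inductive UgRel (n m : ℕ) : TensorAlgebra ℂ (Gl n m) → TensorAlgebra ℂ (Gl n m) → Prop
  | mk (i j : ZMod 2) (x y : Gl n m) (hx : x ∈ glGr n m i) (hy : y ∈ glGr n m j) :
      UgRel n m (sbracket i j (TensorAlgebra.ι ℂ x) (TensorAlgebra.ι ℂ y))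
        (TensorAlgebra.ι ℂ (sbracket i j x y))

/-- The universal enveloping algebra `U(gl(n,2m))`. -/
def Ug (n m : ℕ) := (ringConGen (UgRel n m)).Quotient

instance (n m : ℕ) : Ring (Ug n m) := inferInstanceAs (Ring (ringConGen (UgRel n m)).Quotient)

instance (n m : ℕ) : Algebra ℂ (Ug n m) :=
  inferInstanceAs (Algebra ℂ (ringConGen (UgRel n m)).Quotient)

/-- The quotient map from the tensor algebra to `U(gl(n,2m))`. -/
def ugMk (n m : ℕ) : TensorAlgebra ℂ (Gl n m) →ₐ[ℂ] Ug n m := RingCon.mkₐ ℂ (ringConGen (UgRel n m))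

/-- The canonical map `gl(n,2m) → U(gl(n,2m))`. -/
def ugι {n m : ℕ} : Gl n m →ₗ[ℂ] Ug n m := (ugMk n m).toLinearMap ∘ₗ TensorAlgebra.ι ℂ

theorem ugι_sbracket {n m : ℕ} {i j : ZMod 2} {x y : Gl n m} (hx : x ∈ glGr n m i)
    (hy : y ∈ glGr n m j) : ugι (sbracket i j x y) = sbracket i j (ugι x) (ugι y) := by
  have : ugMk n m (sbracket i j (TensorAlgebra.ι ℂ x) (TensorAlgebra.ι ℂ y)) =
      ugMk n m (TensorAlgebra.ι ℂ (sbracket i j x y)) :=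
    Quotient.sound (RingCon.le_ringConGen _ _ (UgRel.mk i j x y hx hy))
  simp only [ugι, LinearMap.comp_apply, AlgHom.toLinearMap_apply]
  rw [← this]
  simp [sbracket]

/-- The universal property of `U(gl(n,2m))`. -/
def ugLift {n m : ℕ} {A : Type*} [Ring A] [Algebra ℂ A] (f : Gl n m →ₗ[ℂ] A)
    (hf : ∀ (i j : ZMod 2) (x y : Gl n m), x ∈ glGr n m i → y ∈ glGr n m j →
      f (sbracket i j x y) = sbracket i j (f x) (f y)) : Ug n m →ₐ[ℂ] A :=
  RingCon.liftₐ (ringConGen (UgRel n m)) (TensorAlgebra.lift ℂ f) (by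
    grw [RingCon.ringConGen_le]
    rintro _ _ ⟨i, j, x, y, hx, hy⟩
    change TensorAlgebra.lift ℂ f _ = TensorAlgebra.lift ℂ f _
    rw [TensorAlgebra.lift_ι_apply, hf i j x y hx hy]
    simp [sbracket])

@[simp] theorem ugLift_ugι {n m : ℕ} {A : Type*} [Ring A] [Algebra ℂ A] (f : Gl n m →ₗ[ℂ] A)
    (hf : ∀ (i j : ZMod 2) (x y : Gl n m), x ∈ glGr n m i → y ∈ glGr n m j →
      f (sbracket i j x y) = sbracket i j (f x) (f y)) (x : Gl n m) :
    ugLift f hf (ugι x) = f x := by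
  change TensorAlgebra.lift ℂ f (TensorAlgebra.ι ℂ x) = f x
  simp

/-- The parity automorphism of `U(gl(n,2m))`, equal to `(-1)^{p(x)} x` on homogeneous `x`. -/
def ugPar {n m : ℕ} : Ug n m →ₐ[ℂ] Ug n m :=
  ugLift (ugι ∘ₗ (glProj 0 - glProj 1)) (by
    intro i j x y hx hy
    have hxy := sbracket_mem_glGr hx hy
    have key := ugι_sbracket hx hy
    have h10 : (1 : ZMod 2) ≠ 0 := by decide
    have h01 : (0 : ZMod 2) ≠ 1 := by decide
    rcases zmod_two_cases i with rfl | rfl <;> rcases zmod_two_cases j with rfl | rfl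
    · rw [zero_add] at hxy
      simp [glProj_of_mem hxy, glProj_of_mem_ne h01 hxy, glProj_of_mem hx,
        glProj_of_mem_ne h01 hx, glProj_of_mem hy, glProj_of_mem_ne h01 hy, key]
    · rw [zero_add] at hxy
      simp [glProj_of_mem hxy, glProj_of_mem_ne h10 hxy, glProj_of_mem hx,
        glProj_of_mem_ne h01 hx, glProj_of_mem hy, glProj_of_mem_ne h10 hy, key]
      simp [sbracket]
      abel
    · rw [add_zero] at hxy
      simp [glProj_of_mem hxy, glProj_of_mem_ne h10 hxy, glProj_of_mem hx,
        glProj_of_mem_ne h10 hx, glProj_of_mem hy, glProj_of_mem_ne h01 hy, key]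
      simp [sbracket]
      abel
    · rw [show (1 : ZMod 2) + 1 = 0 by decide] at hxy
      simp [glProj_of_mem hxy, glProj_of_mem_ne h01 hxy, glProj_of_mem hx,
        glProj_of_mem_ne h10 hx, glProj_of_mem hy, glProj_of_mem_ne h10 hy, key]
      simp [sbracket])

theorem ugPar_ugι_even {n m : ℕ} {x : Gl n m} (hx : x ∈ glGr n m 0) :
    ugPar (ugι x) = ugι x := by
  simp [ugPar, glProj_of_mem hx, glProj_of_mem_ne (show (0 : ZMod 2) ≠ 1 by decide) hx]

theorem ugPar_ugι_odd {n m : ℕ} {x : Gl n m} (hx : x ∈ glGr n m 1) :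
    ugPar (ugι x) = -ugι x := by
  simp [ugPar, glProj_of_mem hx, glProj_of_mem_ne (show (1 : ZMod 2) ≠ 0 by decide) hx]

theorem ugPar_ugPar {n m : ℕ} (w : Ug n m) : ugPar (ugPar w) = w := by
  have h : (ugPar.comp ugPar : Ug n m →ₐ[ℂ] Ug n m) = AlgHom.id ℂ _ := by
    apply RingCon.Quotient.hom_extₐ
    apply TensorAlgebra.hom_ext
    ext1 x
    change ugPar (ugPar (ugι x)) = ugι x
    have hx : x = glProj 0 x + glProj 1 x := by
      ext a b
      rcases zmod_two_cases (idxPar a + idxPar b) with h | h <;> simp [glProj, h]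
    rw [hx]
    simp only [map_add, ugPar_ugι_even (glProj_mem 0 x), ugPar_ugι_odd (glProj_mem 1 x), map_neg,
      neg_neg]
  exact DFunLike.congr_fun h w

/-- The component of parity `i` of an element of `U(gl(n,2m))`. -/
def ugComp {n m : ℕ} (i : ZMod 2) (w : Ug n m) : Ug n m :=
  (2 : ℂ)⁻¹ • (w + sgn i 1 • ugPar w)

/-- Auxiliary for the principal anti-automorphism: `y ∈ gl(n,2m)` of parity `i` acts on
`U(gl(n,2m))` by `w ↦ -(-1)^{i p(w)} w y`. -/
def ugRight {n m : ℕ} : Gl n m →ₗ[ℂ] Module.End ℂ (Ug n m) :=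
  -((LinearMap.mul ℂ (Ug n m)).flip ∘ₗ ugι ∘ₗ glProj 0)
    - (LinearMap.lcomp ℂ (Ug n m) ugPar.toLinearMap) ∘ₗ
      ((LinearMap.mul ℂ (Ug n m)).flip ∘ₗ ugι ∘ₗ glProj 1)

theorem ugRight_even {n m : ℕ} {y : Gl n m} (hy : y ∈ glGr n m 0) (w : Ug n m) :
    ugRight y w = -(w * ugι y) := by
  simp [ugRight, glProj_of_mem hy, glProj_of_mem_ne (show (0 : ZMod 2) ≠ 1 by decide) hy]

theorem ugRight_odd {n m : ℕ} {y : Gl n m} (hy : y ∈ glGr n m 1) (w : Ug n m) :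
    ugRight y w = -(ugPar w * ugι y) := by
  simp [ugRight, glProj_of_mem hy, glProj_of_mem_ne (show (1 : ZMod 2) ≠ 0 by decide) hy]

theorem ugRight_sbracket {n m : ℕ} (i j : ZMod 2) (x y : Gl n m) (hx : x ∈ glGr n m i)
    (hy : y ∈ glGr n m j) :
    ugRight (sbracket i j x y) = sbracket i j (ugRight x) (ugRight y) := by
  have hxy := sbracket_mem_glGr hx hy
  have key := ugι_sbracket hx hy
  refine LinearMap.ext fun w => ?_
  rcases zmod_two_cases i with rfl | rfl <;> rcases zmod_two_cases j with rfl | rfl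
  · rw [zero_add] at hxy
    rw [ugRight_even hxy, key]
    simp [sbracket, ugRight_even hx, ugRight_even hy, mul_sub, mul_assoc]
  · rw [zero_add] at hxy
    rw [ugRight_odd hxy, key]
    simp [sbracket, ugRight_even hx, ugRight_odd hy, mul_sub, mul_assoc, ugPar_ugι_even hx]
  · rw [add_zero] at hxy
    rw [ugRight_odd hxy, key]
    simp [sbracket, ugRight_odd hx, ugRight_even hy, mul_sub, mul_assoc, ugPar_ugι_even hy]
  · rw [show (1 : ZMod 2) + 1 = 0 by decide] at hxy
    rw [ugRight_even hxy, key]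
    simp [sbracket, ugRight_odd hx, ugRight_odd hy, mul_add, mul_assoc, ugPar_ugι_odd hx,
      ugPar_ugι_odd hy, ugPar_ugPar]

/-- The principal anti-automorphism `y ↦ yᵗ` of the superalgebra `U(gl(n,2m))`, determined by
`1ᵗ = 1`, `yᵗ = -y` for `y ∈ gl(n,2m)` and `(yw)ᵗ = (-1)^{p(y)p(w)} wᵗ yᵗ`. -/
def ugT {n m : ℕ} (y : Ug n m) : Ug n m := ugLift ugRight ugRight_sbracket y 1

theorem ugT_one {n m : ℕ} : ugT (1 : Ug n m) = 1 := by simp [ugT]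

theorem ugT_ugι {n m : ℕ} (y : Gl n m) : ugT (ugι y) = -ugι y := by
  have hy : y = glProj 0 y + glProj 1 y := by
    ext a b
    rcases zmod_two_cases (idxPar a + idxPar b) with h | h <;> simp [glProj, h]
  have h : ugT (ugι y) = ugRight y 1 := by simp [ugT]
  rw [h, hy, map_add, LinearMap.add_apply, ugRight_even (glProj_mem 0 y),
    ugRight_odd (glProj_mem 1 y)]
  simp [add_comm]

theorem ugT_ugι_mul_even {n m : ℕ} {y : Gl n m} (hy : y ∈ glGr n m 0) (w : Ug n m) :
    ugT (ugι y * w) = ugT w * ugT (ugι y) := by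
  rw [ugT_ugι, mul_neg, ← ugRight_even hy]
  simp [ugT]

theorem ugT_ugι_mul_odd {n m : ℕ} {y : Gl n m} (hy : y ∈ glGr n m 1) (w : Ug n m) :
    ugT (ugι y * w) = ugPar (ugT w) * ugT (ugι y) := by
  rw [ugT_ugι, mul_neg, ← ugRight_odd hy]
  simp [ugT]

/-! ### The dual of `U(gl(n,2m))`, zonal and zonal spherical functions -/

/-- The full dual `U(gl(n,2m))^*`. -/
abbrev UgDual (n m : ℕ) := Module.Dual ℂ (Ug n m)

/-- The component of parity `j` of a functional; a functional has parity `j` if it vanishes on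
elements of parity other than `j`. -/
def dualComp {n m : ℕ} (j : ZMod 2) (f : UgDual n m) : UgDual n m :=
  (2 : ℂ)⁻¹ • (f + sgn j 1 • (f ∘ₗ ugPar.toLinearMap))

/-- The action `(y f)(x) = (-1)^{p(y)p(f)} f(yᵗ x)` of `U(gl(n,2m))` on its dual, extended
bilinearly from homogeneous `y` and `f`. -/
def dualAct {n m : ℕ} (y : Ug n m) (f : UgDual n m) : UgDual n m :=
  ∑ i : ZMod 2, ∑ j : ZMod 2,
    sgn i j • (dualComp j f ∘ₗ LinearMap.mulLeft ℂ (ugT (ugComp i y)))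

/-- Zonal functions: two-sided `osp(n,2m)`-invariant functionals on `U(gl(n,2m))`. -/
def IsZonal {n m : ℕ} (f : UgDual n m) : Prop :=
  ∀ x ∈ osp n m, ∀ w : Ug n m, f (ugι x * w) = 0 ∧ f (w * ugι x) = 0

/-- Zonal spherical functions: zonal functions which are (nonzero) joint eigenvectors of the centre
of `U(gl(n,2m))`. -/
def IsZonalSpherical {n m : ℕ} (f : UgDual n m) : Prop :=
  IsZonal f ∧ f ≠ 0 ∧ ∀ z ∈ Subalgebra.center ℂ (Ug n m), ∃ c : ℂ, dualAct z f = c • f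

/-! ### Modules over `gl(n,2m)` -/

/-- A `ℤ/2`-graded `gl(n,2m)`-module structure on a complex vector space `U`. -/
structure GLModule (n m : ℕ) (U : Type*) [AddCommGroup U] [Module ℂ U] where
  /-- the homogeneous components of `U` -/
  gr : ZMod 2 → Submodule ℂ U
  isCompl : IsCompl (gr 0) (gr 1)
  /-- the action -/
  act : Gl n m →ₗ[ℂ] Module.End ℂ U
  act_mem : ∀ (i j : ZMod 2), ∀ x ∈ glGr n m i, ∀ u ∈ gr j, act x u ∈ gr (i + j)
  act_sbracket : ∀ (i j : ZMod 2) (x y : Gl n m), x ∈ glGr n m i → y ∈ glGr n m j →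
    act (sbracket i j x y) = sbracket i j (act x) (act y)

namespace GLModule

variable {n m : ℕ} {U : Type*} [AddCommGroup U] [Module ℂ U]

/-- Irreducibility: `U ≠ 0` and there are no graded submodules besides `0` and `U`. -/
def IsIrreducible (M : GLModule n m U) : Prop :=
  Nontrivial U ∧ ∀ W : Submodule ℂ U, W ≤ (W ⊓ M.gr 0) ⊔ (W ⊓ M.gr 1) →
    (∀ x : Gl n m, ∀ u ∈ W, M.act x u ∈ W) → W = ⊥ ∨ W = ⊤

/-- An isomorphism of graded modules: a bijective linear map preserving parity and commuting with
the action. -/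
def IsIsomorphic {U' : Type*} [AddCommGroup U'] [Module ℂ U'] (M : GLModule n m U)
    (M' : GLModule n m U') : Prop :=
  ∃ e : U ≃ₗ[ℂ] U', (∀ i, ∀ u ∈ M.gr i, e u ∈ M'.gr i) ∧
    ∀ (x : Gl n m) (u : U), e (M.act x u) = M'.act x (e u)

/-- The module `U^θ`: the same graded space with `x` acting as `θ(x)`. -/
def twist (M : GLModule n m U) : GLModule n m U where
  gr := M.gr
  isCompl := M.isCompl
  act := M.act ∘ₗ theta
  act_mem i j x hx u hu := M.act_mem i j _ (theta_mem hx) u hu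
  act_sbracket i j x y hx hy := by
    simp only [LinearMap.comp_apply]
    rw [theta_sbracket hx hy, M.act_sbracket i j _ _ (theta_mem hx) (theta_mem hy)]

/-- The parity operator `u ↦ (-1)^{p(u)} u`. -/
def par (M : GLModule n m U) : Module.End ℂ U :=
  (M.gr 0).projection (M.gr 1) M.isCompl - (M.gr 1).projection (M.gr 0) M.isCompl.symm

theorem par_even (M : GLModule n m U) {u : U} (hu : u ∈ M.gr 0) : M.par u = u := by
  have h1 := Submodule.projection_apply_of_mem_left M.isCompl hu
  have h2 : (M.gr 1).projection (M.gr 0) M.isCompl.symm u = 0 := by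
    rw [Submodule.projection_apply_eq_zero_iff]; exact hu
  simp only [par, LinearMap.sub_apply, h1, h2, sub_zero]

theorem par_odd (M : GLModule n m U) {u : U} (hu : u ∈ M.gr 1) : M.par u = -u := by
  have h1 := Submodule.projection_apply_of_mem_left M.isCompl.symm hu
  have h2 : (M.gr 0).projection (M.gr 1) M.isCompl u = 0 := by
    rw [Submodule.projection_apply_eq_zero_iff]; exact hu
  simp only [par, LinearMap.sub_apply, h1, h2, zero_sub]

theorem ext_hom (M : GLModule n m U) {V : Type*} [AddCommGroup V] [Module ℂ V]
    {f g : U →ₗ[ℂ] V} (h : ∀ i, ∀ u ∈ M.gr i, f u = g u) : f = g := by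
  refine LinearMap.ext fun u => ?_
  have hu : u ∈ M.gr 0 ⊔ M.gr 1 := by rw [M.isCompl.sup_eq_top]; trivial
  obtain ⟨a, ha, b, hb, rfl⟩ := Submodule.mem_sup.mp hu
  rw [map_add, map_add, h 0 a ha, h 1 b hb]

theorem par_par (M : GLModule n m U) : M.par ∘ₗ M.par = LinearMap.id := by
  refine M.ext_hom fun i u hu => ?_
  rcases zmod_two_cases i with rfl | rfl
  · simp [M.par_even hu]
  · simp [M.par_odd hu]

theorem par_act_even (M : GLModule n m U) {x : Gl n m} (hx : x ∈ glGr n m 0) :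
    M.par ∘ₗ M.act x = M.act x ∘ₗ M.par := by
  refine M.ext_hom fun i u hu => ?_
  have h := M.act_mem 0 i x hx u hu
  rw [zero_add] at h
  rcases zmod_two_cases i with rfl | rfl
  · simp [M.par_even hu, M.par_even h]
  · simp [M.par_odd hu, M.par_odd h]

theorem par_act_odd (M : GLModule n m U) {x : Gl n m} (hx : x ∈ glGr n m 1) :
    M.par ∘ₗ M.act x = -(M.act x ∘ₗ M.par) := by
  refine M.ext_hom fun i u hu => ?_
  have h := M.act_mem 1 i x hx u hu
  rcases zmod_two_cases i with rfl | rfl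
  · rw [add_zero] at h
    simp [M.par_even hu, M.par_odd h]
  · rw [show (1 : ZMod 2) + 1 = 0 by decide] at h
    simp [M.par_odd hu, M.par_even h]

/-- The functionals of parity `i`. -/
def dualGr (M : GLModule n m U) (i : ZMod 2) : Submodule ℂ (Module.Dual ℂ U) where
  carrier := {f | ∀ j, j ≠ i → ∀ u ∈ M.gr j, f u = 0}
  add_mem' hf hg j hj u hu := by simp [hf j hj u hu, hg j hj u hu]
  zero_mem' := by simp
  smul_mem' c f hf j hj u hu := by simp [hf j hj u hu]

/-- The dual action; `dualAction_apply` is the usual formula. -/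
def dualAction (M : GLModule n m U) : Gl n m →ₗ[ℂ] Module.End ℂ (Module.Dual ℂ U) where
  toFun x := -(LinearMap.lcomp ℂ ℂ (M.act (glProj 0 x)))
    - LinearMap.lcomp ℂ ℂ (M.par ∘ₗ M.act (glProj 1 x))
  map_add' x y := by
    ext f u
    simp only [map_add, LinearMap.sub_apply, LinearMap.neg_apply, LinearMap.lcomp_apply,
      LinearMap.add_apply, LinearMap.comp_apply]
    ring
  map_smul' c x := by
    ext f u
    simp only [map_smul, LinearMap.sub_apply, LinearMap.neg_apply, LinearMap.lcomp_apply,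
      LinearMap.smul_apply, LinearMap.comp_apply, smul_eq_mul, RingHom.id_apply]
    ring

theorem dualAction_even (M : GLModule n m U) {x : Gl n m} (hx : x ∈ glGr n m 0)
    (f : Module.Dual ℂ U) : M.dualAction x f = -(f ∘ₗ M.act x) := by
  ext u
  simp [dualAction, glProj_of_mem hx, glProj_of_mem_ne (show (0 : ZMod 2) ≠ 1 by decide) hx]

theorem dualAction_odd (M : GLModule n m U) {x : Gl n m} (hx : x ∈ glGr n m 1)
    (f : Module.Dual ℂ U) : M.dualAction x f = -(f ∘ₗ M.par ∘ₗ M.act x) := by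
  ext u
  simp [dualAction, glProj_of_mem hx, glProj_of_mem_ne (show (1 : ZMod 2) ≠ 0 by decide) hx]

theorem dualGr_par_even (M : GLModule n m U) {f : Module.Dual ℂ U} (hf : f ∈ M.dualGr 0) :
    f ∘ₗ M.par = f := by
  refine M.ext_hom fun i u hu => ?_
  rcases zmod_two_cases i with rfl | rfl
  · simp [M.par_even hu]
  · simp [M.par_odd hu, hf 1 (by decide) u hu]

theorem dualGr_par_odd (M : GLModule n m U) {f : Module.Dual ℂ U} (hf : f ∈ M.dualGr 1) :
    f ∘ₗ M.par = -f := by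
  refine M.ext_hom fun i u hu => ?_
  rcases zmod_two_cases i with rfl | rfl
  · simp [M.par_even hu, hf 0 (by decide) u hu]
  · simp [M.par_odd hu]

/-- The formula `(x f)(u) = -(-1)^{p(x)p(f)} f(x u)` for the dual action. -/
theorem dualAction_apply (M : GLModule n m U) {i j : ZMod 2} {x : Gl n m} (hx : x ∈ glGr n m i)
    {f : Module.Dual ℂ U} (hf : f ∈ M.dualGr j) (u : U) :
    M.dualAction x f u = -(sgn i j * f (M.act x u)) := by
  rcases zmod_two_cases i with rfl | rfl
  · simp [M.dualAction_even hx]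
  · rw [M.dualAction_odd hx, ← LinearMap.comp_assoc]
    rcases zmod_two_cases j with rfl | rfl
    · rw [M.dualGr_par_even hf]; simp
    · rw [M.dualGr_par_odd hf]; simp

/-- The dual module `U^*`. -/
def dual (M : GLModule n m U) : GLModule n m (Module.Dual ℂ U) where
  gr := M.dualGr
  isCompl := by
    have h01 : (0 : ZMod 2) ≠ 1 := by decide
    have h10 : (1 : ZMod 2) ≠ 0 := by decide
    constructor
    · rw [Submodule.disjoint_def]
      intro f h0 h1
      refine M.ext_hom fun i u hu => ?_
      rcases zmod_two_cases i with rfl | rfl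
      · exact h1 0 h01 u hu
      · exact h0 1 h10 u hu
    · rw [codisjoint_iff, eq_top_iff]
      intro f _
      have hf : f = (2 : ℂ)⁻¹ • (f + f ∘ₗ M.par) + (2 : ℂ)⁻¹ • (f - f ∘ₗ M.par) := by
        ext u
        simp only [LinearMap.add_apply, LinearMap.smul_apply, LinearMap.sub_apply, smul_eq_mul]
        ring
      rw [hf]
      refine Submodule.add_mem_sup ?_ ?_
      · intro j hj u hu
        rcases zmod_two_cases j with rfl | rfl
        · exact absurd rfl hj
        · simp [M.par_odd hu]
      · intro j hj u hu
        rcases zmod_two_cases j with rfl | rfl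
        · simp [M.par_even hu]
        · exact absurd rfl hj
  act := M.dualAction
  act_mem i j x hx f hf k hk u hu := by
    rw [M.dualAction_apply hx hf, hf (i + k) ?_ _ (M.act_mem i k x hx u hu)]
    · simp
    · intro h
      apply hk
      rw [← h]
      have h2 : ∀ a b : ZMod 2, b = a + (a + b) := by decide
      exact h2 i k
  act_sbracket i j x y hx hy := by
    have hxy := sbracket_mem_glGr hx hy
    have key := M.act_sbracket i j x y hx hy
    refine LinearMap.ext fun f => ?_
    rcases zmod_two_cases i with rfl | rfl <;> rcases zmod_two_cases j with rfl | rfl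
    · rw [zero_add] at hxy
      rw [M.dualAction_even hxy, key]
      ext u
      simp [sbracket, M.dualAction_even hx, M.dualAction_even hy]
    · rw [zero_add] at hxy
      rw [M.dualAction_odd hxy, key]
      ext u
      have h := LinearMap.congr_fun (M.par_act_even hx) (M.act y u)
      simp only [LinearMap.comp_apply] at h
      simp [sbracket, M.dualAction_even hx, M.dualAction_odd hy, h]
    · rw [add_zero] at hxy
      rw [M.dualAction_odd hxy, key]
      ext u
      have h := LinearMap.congr_fun (M.par_act_even hy) (M.act x u)
      simp only [LinearMap.comp_apply] at h
      simp [sbracket, M.dualAction_odd hx, M.dualAction_even hy, h]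
    · rw [show (1 : ZMod 2) + 1 = 0 by decide] at hxy
      rw [M.dualAction_even hxy, key]
      ext u
      have h1 := LinearMap.congr_fun (M.par_act_odd hy) (M.act x u)
      have h2 := LinearMap.congr_fun (M.par_act_odd hx) (M.act y u)
      have h3 := fun v => LinearMap.congr_fun M.par_par v
      simp only [LinearMap.comp_apply, LinearMap.neg_apply, LinearMap.id_apply] at h1 h2 h3
      have h4 : M.par (M.act y (M.par (M.act x u))) = -M.act y (M.act x u) := by
        have := LinearMap.congr_fun (M.par_act_odd hy) (M.par (M.act x u))
        simp only [LinearMap.comp_apply, LinearMap.neg_apply] at this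
        rw [this, h3]
      have h5 : M.par (M.act x (M.par (M.act y u))) = -M.act x (M.act y u) := by
        have := LinearMap.congr_fun (M.par_act_odd hx) (M.par (M.act y u))
        simp only [LinearMap.comp_apply, LinearMap.neg_apply] at this
        rw [this, h3]
      simp [sbracket, M.dualAction_odd hx, M.dualAction_odd hy, h4, h5]

/-- The extension of the action to `U(gl(n,2m))`. -/
def uact (M : GLModule n m U) : Ug n m →ₐ[ℂ] Module.End ℂ U := ugLift M.act M.act_sbracket

/-- The space of vectors `u` with `x u = 0` for all `x ∈ osp(n,2m)`. -/
def kInv (M : GLModule n m U) : Submodule ℂ U where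
  carrier := {u | ∀ x ∈ osp n m, M.act x u = 0}
  add_mem' hu hv x hx := by simp [hu x hx, hv x hx]
  zero_mem' := by simp
  smul_mem' c u hu x hx := by simp [hu x hx]

/-- The relation `exp(T) u = v` in a finite-dimensional space: `∑ Tᵏu / k!` converges to `v`,
tested coordinatewise, that is, on all linear functionals. -/
def ExpEq (T : Module.End ℂ U) (u v : U) : Prop :=
  ∀ f : Module.Dual ℂ U, HasSum (fun k : ℕ => ((k.factorial : ℂ))⁻¹ * f ((T ^ k) u)) (f v)

/-- The space of vectors killed by `osp(n,2m)` and, in addition, fixed by `O(n) ⊂ OSP(n,2m)`. The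
group `GL(n)` acts by `exp(X) u = ∑ Xᵏu / k!` for `X ∈ gl(n)`; as `exp` maps `gl(n)` onto `GL(n)`,
invariance under `O(n)` is invariance under all `exp(X)` with `exp(X) ∈ O(n)`. -/
def kInvO (M : GLModule n m U) : Submodule ℂ U where
  carrier := {u | u ∈ M.kInv ∧ ∀ X : Matrix (Fin n) (Fin n) ℂ,
    NormedSpace.exp X ∈ Matrix.orthogonalGroup (Fin n) ℂ →
      ExpEq (M.act (Matrix.fromBlocks X 0 0 0)) u u}
  add_mem' {u v} hu hv := by
    refine ⟨M.kInv.add_mem hu.1 hv.1, fun X hX f => ?_⟩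
    simpa [mul_add] using (hu.2 X hX f).add (hv.2 X hX f)
  zero_mem' := ⟨M.kInv.zero_mem, fun X _ f => by simp⟩
  smul_mem' c u hu := by
    refine ⟨M.kInv.smul_mem c hu.1, fun X hX f => ?_⟩
    simpa [mul_left_comm] using (hu.2 X hX f).mul_left c

/-- The matrix coefficient `φ_{u,l}(x) = l(x u)`. -/
def phi (M : GLModule n m U) (u : U) (l : Module.Dual ℂ U) : UgDual n m :=
  l ∘ₗ LinearMap.applyₗ u ∘ₗ M.uact.toLinearMap

/-- The linear space spanned by the functions `φ_{u,l}` with `u ∈ A`, `l ∈ B`; for `A = U^k` and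
`B = (U^*)^k` this is `Z(U)`. -/
def zonalSpace (M : GLModule n m U) (A : Submodule ℂ U) (B : Submodule ℂ (Module.Dual ℂ U)) :
    Submodule ℂ (UgDual n m) :=
  Submodule.span ℂ {f | ∃ u ∈ A, ∃ l ∈ B, f = M.phi u l}

end GLModule

end GLOsp

end

/-! Everything rests on highest weight theory for an ordering of the standard basis in which the two
members of each symplectic pair are adjacent. Let σ interchange the members of every pair. On matrix
units θ sends E_ij to ±E_{σj,σi}, so it reverses the ordering up to σ.

For (1), take a highest weight vector v of U, of weight λ. In U^θ the same v is a highest weight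
vector of weight -λ∘σ for the reverse of the σ-permuted ordering. In U itself, one reflection in an
even simple root per symplectic pair, each an sl₂ computation, turns v into a vector v' of the same
parity and of weight λ∘σ, highest for the σ-permuted ordering. A highest weight functional l for the
reversed ordering cannot vanish at v', so it has weight -λ∘σ and the parity of v. Thus U^θ and U^*
have the same highest weight and parity for the same Borel subalgebra, and no odd reflection is
needed. The submodule of U^θ ⊕ U^* generated by (v, l) is then the graph of an isomorphism.

For (2), the Iwasawa decomposition `mem_span_osp_union_borel` gives U = U(𝔨)v, so a 𝔨-invariant
functional is determined by its value at v, and dim (U^*)^𝔨 ≤ 1. As θ fixes 𝔨 pointwise, the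
isomorphism of (1) carries U^𝔨 onto (U^*)^𝔨.

For (3), the centre acts on U by scalars (`IsIrreducible.exists_eq_smul`), and the at most
one-dimensional spaces U^𝔨 and (U^*)^𝔨 are stable under parity, so φ_{u,l} is homogeneous and the
signs in the action on U(𝔤)^* only change the scalars. It is nonzero because u generates U. For
O(n): θ(X) = -Xᵀ on 𝔤𝔩(n), and exp(-Xᵀ) = exp(X) whenever exp(X) is orthogonal, so the isomorphism
of (1) respects O(n)-invariance as well.

The common tool is `exists_stable_le_ker`, which takes the place of the PBW theorem: if 𝔤 is spanned
by A and B, and B preserves the line of v, then words in A alone applied to v span U(𝔤)v. -/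

noncomputable section

namespace GLOsp

/-! ### Matrix units -/

/-- The matrix unit of `gl(n,2m)` at position `(i, j)`. -/
def matUnit {n m : ℕ} (i j : Idx n m) : Gl n m := Matrix.single i j 1

theorem matUnit_mem {n m : ℕ} (i j : Idx n m) : matUnit i j ∈ glGr n m (idxPar i + idxPar j) := by
  intro a b h
  by_cases h' : i = a ∧ j = b
  · obtain ⟨rfl, rfl⟩ := h'
    exact absurd rfl h
  · exact Matrix.single_apply_of_ne _ _ _ _ _ h'

theorem zmod_two_add_self (i : ZMod 2) : i + i = 0 := by
  revert i; decide

theorem matUnit_self_mem {n m : ℕ} (i : Idx n m) : matUnit i i ∈ glGr n m 0 := by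
  have h := matUnit_mem i i
  rwa [zmod_two_add_self] at h

theorem mem_span_matUnit {n m : ℕ} (S : Submodule ℂ (Gl n m)) (h : ∀ i j, matUnit i j ∈ S)
    (x : Gl n m) : x ∈ S := by
  rw [Matrix.matrix_eq_sum_single x]
  refine S.sum_mem fun i _ => S.sum_mem fun j _ => ?_
  have h' := S.smul_mem (x i j) (h i j)
  rwa [matUnit, Matrix.smul_single, smul_eq_mul, mul_one] at h'

theorem matUnit_mul_same {n m : ℕ} (i j k : Idx n m) :
    matUnit i j * matUnit j k = matUnit i k := by
  simp [matUnit]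

theorem matUnit_mul_of_ne {n m : ℕ} {i j k l : Idx n m} (h : j ≠ k) :
    matUnit i j * matUnit k l = 0 := by
  simp [matUnit, h]

theorem sbracket_matUnit_self {n m : ℕ} (i j k : Idx n m) (p : ZMod 2) :
    sbracket 0 p (matUnit i i) (matUnit j k) =
      ((if i = j then 1 else 0) - (if k = i then 1 else 0) : ℂ) • matUnit j k := by
  simp only [sbracket, sgn_zero_left, one_smul, sub_smul]
  congr 1
  · split_ifs with h
    · subst h; simp [matUnit_mul_same]
    · simp [matUnit_mul_of_ne h]
  · split_ifs with h
    · subst h; simp [matUnit_mul_same]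
    · simp [matUnit_mul_of_ne h]

theorem glProj_add {n m : ℕ} (x : Gl n m) : glProj 0 x + glProj 1 x = x := by
  ext a b
  rcases zmod_two_cases (idxPar a + idxPar b) with h | h <;> simp [glProj, h]

namespace GLModule

variable {n m : ℕ} {U : Type*} [AddCommGroup U] [Module ℂ U]

/-! ### The parity operator and graded submodules -/

theorem par_par_apply (M : GLModule n m U) (u : U) : M.par (M.par u) = u :=
  LinearMap.congr_fun M.par_par u

theorem half_add_par_mem (M : GLModule n m U) (u : U) : (2 : ℂ)⁻¹ • (u + M.par u) ∈ M.gr 0 := by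
  have hu : u ∈ M.gr 0 ⊔ M.gr 1 := by rw [M.isCompl.sup_eq_top]; trivial
  obtain ⟨a, ha, b, hb, rfl⟩ := Submodule.mem_sup.mp hu
  rw [map_add, M.par_even ha, M.par_odd hb]
  have : (2 : ℂ)⁻¹ • (a + b + (a + -b)) = a := by module
  rwa [this]

theorem half_sub_par_mem (M : GLModule n m U) (u : U) : (2 : ℂ)⁻¹ • (u - M.par u) ∈ M.gr 1 := by
  have hu : u ∈ M.gr 0 ⊔ M.gr 1 := by rw [M.isCompl.sup_eq_top]; trivial
  obtain ⟨a, ha, b, hb, rfl⟩ := Submodule.mem_sup.mp hu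
  rw [map_add, M.par_even ha, M.par_odd hb]
  have : (2 : ℂ)⁻¹ • (a + b - (a + -b)) = b := by module
  rwa [this]

/-- Encodes the grading in one operator, so that homogeneity becomes an eigenvector equation and
gradedness of a subspace becomes stability under `par`. -/
theorem mem_gr_iff_par (M : GLModule n m U) (i : ZMod 2) (u : U) :
    u ∈ M.gr i ↔ M.par u = sgn i 1 • u := by
  rcases zmod_two_cases i with rfl | rfl
  · refine ⟨fun h => by simp [M.par_even h], fun h => ?_⟩
    have h' := M.half_add_par_mem u
    have e : (2 : ℂ)⁻¹ • (u + M.par u) = u := by rw [h, sgn_zero_left]; module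
    rwa [e] at h'
  · refine ⟨fun h => by simp [M.par_odd h], fun h => ?_⟩
    have h' := M.half_sub_par_mem u
    have e : (2 : ℂ)⁻¹ • (u - M.par u) = u := by rw [h, sgn_one_one]; module
    rwa [e] at h'

theorem par_act (M : GLModule n m U) {i : ZMod 2} {x : Gl n m} (hx : x ∈ glGr n m i) (u : U) :
    M.par (M.act x u) = sgn i 1 • M.act x (M.par u) := by
  rcases zmod_two_cases i with rfl | rfl
  · simpa using LinearMap.congr_fun (M.par_act_even hx) u
  · simpa using LinearMap.congr_fun (M.par_act_odd hx) u

theorem sgn_ne_zero (i j : ZMod 2) : sgn i j ≠ 0 := by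
  unfold sgn; split_ifs <;> simp

/-- The submodule `W` is stable under `gl(n,2m)`. -/
def Stable (M : GLModule n m U) (W : Submodule ℂ U) : Prop :=
  ∀ x : Gl n m, ∀ u ∈ W, M.act x u ∈ W

theorem stable_of_homogeneous (M : GLModule n m U) {W : Submodule ℂ U}
    (h : ∀ i, ∀ x ∈ glGr n m i, ∀ u ∈ W, M.act x u ∈ W) : M.Stable W := by
  intro x u hu
  rw [← glProj_add x, map_add]
  exact W.add_mem (h 0 _ (glProj_mem 0 x) u hu) (h 1 _ (glProj_mem 1 x) u hu)

theorem IsIrreducible.eq_bot_or_eq_top {M : GLModule n m U} (hM : M.IsIrreducible)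
    {W : Submodule ℂ U} (hW : M.Stable W) (hp : ∀ u ∈ W, M.par u ∈ W) : W = ⊥ ∨ W = ⊤ := by
  refine hM.2 W (fun u hu => ?_) hW
  have e : u = (2 : ℂ)⁻¹ • (u + M.par u) + (2 : ℂ)⁻¹ • (u - M.par u) := by module
  rw [e]
  exact Submodule.add_mem_sup
    ⟨W.smul_mem _ (W.add_mem hu (hp u hu)), M.half_add_par_mem u⟩
    ⟨W.smul_mem _ (W.sub_mem hu (hp u hu)), M.half_sub_par_mem u⟩

/-- The largest graded subspace of a stable subspace is stable. -/
theorem Stable.graded_core {M : GLModule n m U} {W : Submodule ℂ U} (hW : M.Stable W) :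
    M.Stable (W ⊓ W.comap M.par) := by
  refine M.stable_of_homogeneous fun i x hx u hu => ⟨hW x u hu.1, ?_⟩
  rw [SetLike.mem_coe, Submodule.mem_comap, M.par_act hx]
  exact W.smul_mem _ (hW x _ hu.2)

theorem par_mem_graded_core (M : GLModule n m U) {W : Submodule ℂ U} {u : U}
    (hu : u ∈ W ⊓ W.comap M.par) : M.par u ∈ W ⊓ W.comap M.par := by
  refine ⟨hu.2, ?_⟩
  rw [SetLike.mem_coe, Submodule.mem_comap, par_par_apply]
  exact hu.1

/-- `W` itself need not be graded: its graded core is a graded submodule, and it contains `v`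
because `v` is homogeneous. -/
theorem IsIrreducible.eq_top_of_mem {M : GLModule n m U} (hM : M.IsIrreducible)
    {W : Submodule ℂ U} (hW : M.Stable W) {v : U} (hv0 : v ≠ 0) {ε : ℂ} (hv : M.par v = ε • v)
    (hvW : v ∈ W) : W = ⊤ := by
  have hmem : v ∈ W ⊓ W.comap M.par := ⟨hvW, by
    rw [SetLike.mem_coe, Submodule.mem_comap, hv]; exact W.smul_mem _ hvW⟩
  rcases hM.eq_bot_or_eq_top hW.graded_core (fun u hu => M.par_mem_graded_core hu) with h | h
  · rw [h] at hmem
    exact absurd (by simpa using hmem) hv0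
  · exact eq_top_iff.mpr (h ▸ inf_le_left)

theorem act_act (M : GLModule n m U) {i j : ZMod 2} {x y : Gl n m} (hx : x ∈ glGr n m i)
    (hy : y ∈ glGr n m j) (u : U) :
    M.act x (M.act y u) = M.act (sbracket i j x y) u + sgn i j • M.act y (M.act x u) := by
  rw [M.act_sbracket i j x y hx hy]
  simp [sbracket]

/-- If `gl(n,2m)` is spanned by homogeneous elements of `A` and `B`, and `B` preserves the line
through `v`, then a functional which vanishes at `v` and on the image of `A` vanishes on the graded
submodule generated by `v`. -/
theorem exists_stable_le_ker (M : GLModule n m U) {A B : Set (Gl n m)}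
    (hA : ∀ a ∈ A, ∃ i, a ∈ glGr n m i) (hB : ∀ b ∈ B, ∃ i, b ∈ glGr n m i)
    (hAB : ∀ x, x ∈ Submodule.span ℂ (A ∪ B)) {v : U} {ε : ℂ} (hv : M.par v = ε • v)
    (hBv : ∀ b ∈ B, ∃ c : ℂ, M.act b v = c • v) (f : U →ₗ[ℂ] ℂ) (hfv : f v = 0)
    (hfA : ∀ a ∈ A, ∀ u, f (M.act a u) = 0) :
    ∃ W : Submodule ℂ U, M.Stable W ∧ (∀ u ∈ W, M.par u ∈ W) ∧ v ∈ W ∧ ∀ u ∈ W, f u = 0 := by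
  -- `S` is the span of all words in `A` applied to `v`, described as a smallest subspace so that
  -- containments follow from minimality.
  let C : Set (Submodule ℂ U) := {W | v ∈ W ∧ ∀ a ∈ A, ∀ u ∈ W, M.act a u ∈ W}
  let S : Submodule ℂ U := sInf C
  have hvS : v ∈ S := (Submodule.mem_sInf).mpr fun W hW => hW.1
  have hSA : ∀ a ∈ A, ∀ u ∈ S, M.act a u ∈ S := fun a ha u hu =>
    (Submodule.mem_sInf).mpr fun W hW => hW.2 a ha u ((Submodule.mem_sInf).mp hu W hW)
  have hmin : ∀ W ∈ C, S ≤ W := fun W hW => sInf_le hW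
  have hspan : ∀ u, (∀ a ∈ A, M.act a u ∈ S) → (∀ b ∈ B, M.act b u ∈ S) →
      ∀ x, M.act x u ∈ S := by
    intro u hu1 hu2 x
    have := Submodule.span_le (p := S.comap (M.act.flip u)) (s := A ∪ B).mpr (by
      rintro y (hy | hy)
      · exact hu1 y hy
      · exact hu2 y hy) (hAB x)
    exact this
  -- `B`-stability of `S` amounts to `S ≤ Q`. The set `Q` is `A`-stable because b a u = [b,a]u ± a b
  -- u, where [b,a] lies in the span of `A ∪ B` and so sends u ∈ `Q` into `S`.
  let Q : Submodule ℂ U := S ⊓ ⨅ b : B, S.comap (M.act b)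
  have memQ : ∀ u, u ∈ Q ↔ u ∈ S ∧ ∀ b ∈ B, M.act b u ∈ S := by
    intro u
    simp [Q, Submodule.mem_iInf]
  have hQ : S ≤ Q := by
    refine hmin Q ⟨(memQ v).mpr ⟨hvS, fun b hb => ?_⟩, fun a ha u hu => ?_⟩
    · obtain ⟨c, hc⟩ := hBv b hb
      rw [hc]
      exact S.smul_mem _ hvS
    · rw [memQ] at hu ⊢
      refine ⟨hSA a ha u hu.1, fun b hb => ?_⟩
      obtain ⟨i, hi⟩ := hB b hb
      obtain ⟨j, hj⟩ := hA a ha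
      rw [M.act_act hi hj]
      refine S.add_mem (hspan u (fun a' ha' => hSA a' ha' u hu.1) hu.2 _) (S.smul_mem _ ?_)
      exact hSA a ha _ (hu.2 b hb)
  have hS : M.Stable S := fun x u hu =>
    hspan u (fun a ha => hSA a ha u hu) ((memQ u).mp (hQ hu)).2 x
  have hker : S ≤ LinearMap.ker f := by
    refine hmin _ ⟨hfv, fun a ha u _ => hfA a ha u⟩
  refine ⟨S ⊓ S.comap M.par, hS.graded_core, fun u hu => M.par_mem_graded_core hu, ⟨hvS, ?_⟩,
    fun u hu => hker hu.1⟩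
  rw [SetLike.mem_coe, Submodule.mem_comap, hv]
  exact S.smul_mem _ hvS

/-! ### Highest weight vectors -/

/-- `v` is a homogeneous highest weight vector of weight `wt` with respect to the ordering of the
standard basis given by the rank function `r`; its parity is recorded by the eigenvalue `ε` of the
parity operator. -/
structure IsHighest (M : GLModule n m U) (r : Idx n m → ℤ) (wt : Idx n m → ℂ) (ε : ℂ) (v : U) :
    Prop where
  ne_zero : v ≠ 0
  par : M.par v = ε • v
  raise : ∀ i j, r i < r j → M.act (matUnit i j) v = 0
  weight : ∀ i, M.act (matUnit i i) v = wt i • v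

theorem act_diag_comm (M : GLModule n m U) (i j k : Idx n m) (u : U) :
    M.act (matUnit i i) (M.act (matUnit j k) u) = M.act (matUnit j k) (M.act (matUnit i i) u) +
      ((if i = j then 1 else 0) - (if k = i then 1 else 0) : ℂ) • M.act (matUnit j k) u := by
  rw [M.act_act (matUnit_self_mem i) (matUnit_mem j k), sbracket_matUnit_self]
  simp only [map_smul, LinearMap.smul_apply, sgn_zero_left, one_smul]
  rw [add_comm]

end GLModule

/-- Pairwise commuting operators on a nonzero finite-dimensional complex space have a common
eigenvector in every nonzero subspace which they preserve. -/
theorem exists_common_eigenvector {U : Type*} [AddCommGroup U] [Module ℂ U]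
    [FiniteDimensional ℂ U] {ι : Type*} [Fintype ι] (T : ι → Module.End ℂ U)
    (hT : ∀ i j u, T i (T j u) = T j (T i u)) (W : Submodule ℂ U) (hW : W ≠ ⊥)
    (hTW : ∀ i, ∀ u ∈ W, T i u ∈ W) : ∃ v ∈ W, v ≠ 0 ∧ ∀ i, ∃ c : ℂ, T i v = c • v := by
  classical
  have key : ∀ s : Finset ι, ∃ W' ≤ W, W' ≠ ⊥ ∧ (∀ i, ∀ u ∈ W', T i u ∈ W') ∧
      ∀ i ∈ s, ∃ c : ℂ, ∀ u ∈ W', T i u = c • u := by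
    intro s
    induction s using Finset.induction_on with
    | empty => exact ⟨W, le_rfl, hW, hTW, by simp⟩
    | insert a s _ ih =>
      obtain ⟨W', h1, h2, h3, h4⟩ := ih
      have : Nontrivial W' := Submodule.nontrivial_iff_ne_bot.mpr h2
      obtain ⟨c, hc⟩ := Module.End.exists_eigenvalue ((T a).restrict (h3 a))
      obtain ⟨w, hw⟩ := hc.exists_hasEigenvector
      have hw' : T a (w : U) = c • (w : U) := by
        have := congrArg Subtype.val hw.apply_eq_smul
        simpa using this
      refine ⟨W' ⊓ LinearMap.ker (T a - c • LinearMap.id), inf_le_left.trans h1, ?_, ?_, ?_⟩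
      · intro hbot
        have hmem : (w : U) ∈ W' ⊓ LinearMap.ker (T a - c • LinearMap.id) :=
          ⟨w.2, by simp [hw']⟩
        rw [hbot] at hmem
        exact hw.2 (Subtype.ext (by simpa using hmem))
      · intro i u hu
        refine ⟨h3 i u hu.1, ?_⟩
        have hu2 : T a u - c • u = 0 := by simpa using hu.2
        change T a (T i u) - c • T i u = 0
        rw [hT a i, ← map_smul, ← map_sub, hu2, map_zero]
      · intro i hi
        rcases Finset.mem_insert.mp hi with rfl | hi
        · refine ⟨c, fun u hu => ?_⟩
          have hu2 : T i u - c • u = 0 := by simpa using hu.2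
          exact sub_eq_zero.mp hu2
        · obtain ⟨d, hd⟩ := h4 i hi
          exact ⟨d, fun u hu => hd u hu.1⟩
  obtain ⟨W', h1, h2, -, h4⟩ := key Finset.univ
  obtain ⟨v, hv, hv0⟩ := Submodule.exists_mem_ne_zero_of_ne_bot h2
  refine ⟨v, h1 hv, hv0, fun i => ?_⟩
  obtain ⟨c, hc⟩ := h4 i (Finset.mem_univ i)
  exact ⟨c, hc v hv⟩

namespace GLModule

variable {n m : ℕ} {U : Type*} [AddCommGroup U] [Module ℂ U]

/-- The operator `H` is a diagonal element on which every raising operator has positive weight. Its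
eigenvalue of largest real part therefore has an eigenspace killed by all of them, and the commuting
diagonal operators have a common eigenvector there. -/
theorem exists_isHighest [FiniteDimensional ℂ U] [Nontrivial U] (M : GLModule n m U)
    (r : Idx n m → ℤ) : ∃ wt ε v, M.IsHighest r wt ε v := by
  let H : Module.End ℂ U := ∑ i, (-(r i : ℂ)) • M.act (matUnit i i)
  have hH : ∀ j k u, H (M.act (matUnit j k) u) =
      M.act (matUnit j k) (H u) + ((r k : ℂ) - r j) • M.act (matUnit j k) u := by
    intro j k u
    simp only [H, LinearMap.sum_apply, LinearMap.smul_apply, map_sum, map_smul, act_diag_comm,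
      smul_add, Finset.sum_add_distrib, smul_smul, ← Finset.sum_smul]
    congr 2
    simp only [mul_sub, mul_ite, mul_one, mul_zero, Finset.sum_sub_distrib, Finset.sum_ite_eq,
      Finset.sum_ite_eq', Finset.mem_univ, if_true]
    ring
  have hfin := Module.End.finite_hasEigenvalue H
  obtain ⟨c₀, hc₀⟩ := Module.End.exists_eigenvalue H
  obtain ⟨c, hc, hmax⟩ := Set.exists_max_image _ Complex.re hfin ⟨c₀, hc₀⟩
  have hkill : ∀ i j, r i < r j → ∀ u ∈ H.eigenspace c, M.act (matUnit i j) u = 0 := by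
    intro i j hij u hu
    by_contra hne
    rw [Module.End.mem_eigenspace_iff] at hu
    have h1 : H.HasEigenvalue (c + ((r j : ℂ) - r i)) := by
      refine Module.End.hasEigenvalue_of_hasEigenvector (x := M.act (matUnit i j) u) ⟨?_, hne⟩
      rw [Module.End.mem_eigenspace_iff, hH, hu, map_smul, add_smul]
    have h2 := hmax _ h1
    have h3 : (r i : ℝ) < r j := by exact_mod_cast hij
    simp at h2
    linarith
  -- The index `none` adds the parity operator to the commuting family, which makes the eigenvector
  -- homogeneous.
  let T : Option (Idx n m) → Module.End ℂ U := fun o => o.elim M.par fun i => M.act (matUnit i i)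
  have hpc : ∀ i u, M.par (M.act (matUnit i i) u) = M.act (matUnit i i) (M.par u) := by
    intro i u
    simpa using M.par_act (matUnit_self_mem i) u
  have hac : ∀ i j u, M.act (matUnit i i) (M.act (matUnit j j) u) =
      M.act (matUnit j j) (M.act (matUnit i i) u) := by
    intro i j u
    rw [act_diag_comm]
    simp [eq_comm]
  obtain ⟨v, hv, hv0, hT⟩ := exists_common_eigenvector T (by
    rintro (_ | i) (_ | j) u
    · rfl
    · exact hpc j u
    · exact (hpc i u).symm
    · exact hac i j u) (H.eigenspace c) hc (by
    rintro (_ | i) u hu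
    · rw [Module.End.mem_eigenspace_iff] at hu ⊢
      change H (M.par u) = c • M.par u
      rw [← map_smul, ← hu]
      simp only [H, LinearMap.sum_apply, LinearMap.smul_apply, map_sum, map_smul, hpc]
    · rw [Module.End.mem_eigenspace_iff] at hu ⊢
      change H (M.act _ u) = c • M.act _ u
      rw [hH, hu]
      simp)
  obtain ⟨ε, hε⟩ := hT none
  choose wt hwt using fun i => hT (some i)
  exact ⟨wt, ε, v, hv0, hε, fun i j hij => hkill i j hij v hv, hwt⟩

end GLModule

/-- Finite-dimensional representation theory of `sl₂`: a primitive vector has a natural number `k`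
as its weight and generates a string of length `k + 1`. -/
theorem exists_nat_of_sl2 {U : Type*} [AddCommGroup U] [Module ℂ U] [FiniteDimensional ℂ U]
    {e f h : Module.End ℂ U} (hef : e * f - f * e = h) (hhe : h * e - e * h = (2 : ℂ) • e)
    (hhf : h * f - f * h = -((2 : ℂ) • f)) {v : U} (hv : v ≠ 0) (hev : e v = 0) {c : ℂ}
    (hhv : h v = c • v) :
    ∃ k : ℕ, c = k ∧ (f ^ k) v ≠ 0 ∧ (f ^ (k + 1)) v = 0 := by
  -- `IsSl2Triple` requires `h ≠ 0`. If `h = 0`, the relation for [h,f] forces `f = 0`, and the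
  -- string has length one.
  by_cases h0 : h = 0
  · have hc : c = 0 := by
      rw [h0, LinearMap.zero_apply, eq_comm, smul_eq_zero] at hhv
      exact hhv.resolve_right hv
    have hf : f = 0 := by
      rw [h0, zero_mul, mul_zero, sub_zero, eq_comm, neg_eq_zero, smul_eq_zero] at hhf
      exact hhf.resolve_left two_ne_zero
    exact ⟨0, by simp [hc], by simpa using hv, by simp [hf]⟩
  · let _ : LieRing (Module.End ℂ U) := LieRing.ofAssociativeRing
    have t : IsSl2Triple h e f :=
      { h_ne_zero := h0
        lie_e_f := hef
        lie_h_e_nsmul := by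
          rw [Ring.lie_def, hhe, two_smul, two_nsmul]
        lie_h_f_nsmul := by
          rw [Ring.lie_def, hhf, two_smul, two_nsmul] }
    have P : t.HasPrimitiveVectorWith v c := ⟨hv, hhv, hev⟩
    obtain ⟨k, hk⟩ := P.exists_nat
    have hf : LieModule.toEnd ℂ (Module.End ℂ U) U f = f := rfl
    refine ⟨k, hk, ?_, ?_⟩
    · have := P.pow_toEnd_f_ne_zero_of_eq_nat hk le_rfl
      rwa [hf] at this
    · have := P.pow_toEnd_f_eq_zero_of_eq_nat hk
      rwa [hf] at this

/-! ### The action of `θ` on matrix units -/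

/-- The permutation of the standard basis which interchanges the two members of each symplectic
pair `a` with `a ∈ T`. -/
def pairSwap {n m : ℕ} (T : Finset (Fin m)) : Idx n m → Idx n m
  | .inl i => .inl i
  | .inr (.inl a) => if a ∈ T then .inr (.inr a) else .inr (.inl a)
  | .inr (.inr a) => if a ∈ T then .inr (.inl a) else .inr (.inr a)

/-- The position of a basis vector in an ordering in which symplectic pairs are adjacent. -/
def rank {n m : ℕ} : Idx n m → ℤ
  | .inl i => i
  | .inr (.inl a) => n + 2 * a
  | .inr (.inr a) => n + 2 * a + 1

theorem rank_injective {n m : ℕ} : Function.Injective (rank : Idx n m → ℤ) := by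
  rintro (i | a | a) (j | b | b) h <;> simp only [rank] at h
  · congr 1; ext; omega
  · omega
  · omega
  · omega
  · congr 2; ext; omega
  · omega
  · omega
  · omega
  · congr 2; ext; omega

theorem pairSwap_pairSwap {n m : ℕ} (T : Finset (Fin m)) (k : Idx n m) :
    pairSwap T (pairSwap T k) = k := by
  rcases k with i | a | a
  · rfl
  · by_cases h : a ∈ T <;> simp [pairSwap, h]
  · by_cases h : a ∈ T <;> simp [pairSwap, h]

theorem pairSwap_injective {n m : ℕ} (T : Finset (Fin m)) :
    Function.Injective (pairSwap T : Idx n m → Idx n m) :=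
  Function.LeftInverse.injective (pairSwap_pairSwap T)

theorem pairSwap_insert {n m : ℕ} {T : Finset (Fin m)} {a : Fin m} (ha : a ∉ T) :
    (pairSwap (insert a T) : Idx n m → Idx n m) =
      pairSwap T ∘ Equiv.swap (.inr (.inl a)) (.inr (.inr a)) := by
  funext k
  rcases k with i | b | b
  · simp [pairSwap, Equiv.swap_apply_of_ne_of_ne]
  · by_cases h : b = a
    · subst h; simp [pairSwap, ha]
    · rw [Function.comp_apply, Equiv.swap_apply_of_ne_of_ne (by simp [h]) (by simp)]
      simp [pairSwap, h]
  · by_cases h : b = a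
    · subst h; simp [pairSwap, ha]
    · rw [Function.comp_apply, Equiv.swap_apply_of_ne_of_ne (by simp) (by simp [h])]
      simp [pairSwap, h]

/-- Each symplectic pair occupies two consecutive ranks, so the swap alters the relative order only
inside a pair. -/
theorem rank_pairSwap_lt {n m : ℕ} {i j : Idx n m} (h : rank j < rank i) :
    rank (pairSwap Finset.univ j) < rank (pairSwap Finset.univ i) ∨
      ∃ a, i = .inr (.inr a) ∧ j = .inr (.inl a) := by
  rcases i with i | a | a <;> rcases j with j | b | b <;>
    simp only [rank, pairSwap, Finset.mem_univ, if_true] at h ⊢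
  · left; omega
  · left; omega
  · left; omega
  · left; omega
  · left; omega
  · left; omega
  · left; omega
  · by_cases hab : a = b
    · right; exact ⟨a, rfl, by rw [hab]⟩
    · left
      have : (a : ℕ) ≠ b := fun h' => hab (Fin.ext h')
      omega
  · left; omega

/-- The coefficients of `θ` with respect to the matrix units. -/
def thetaCoeff {n m : ℕ} : Idx n m → Idx n m → ℂ
  | .inl _, .inl _ => -1
  | .inl _, .inr (.inl _) => -1
  | .inl _, .inr (.inr _) => 1
  | .inr (.inl _), .inl _ => 1
  | .inr (.inr _), .inl _ => -1
  | .inr (.inl _), .inr (.inl _) => -1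
  | .inr (.inl _), .inr (.inr _) => 1
  | .inr (.inr _), .inr (.inl _) => 1
  | .inr (.inr _), .inr (.inr _) => -1

theorem theta_apply {n m : ℕ} (x : Gl n m) (a b : Idx n m) :
    theta x a b = thetaCoeff a b * x (pairSwap Finset.univ b) (pairSwap Finset.univ a) := by
  rcases a with a | a | a <;> rcases b with b | b | b <;>
    simp [theta, thetaCoeff, pairSwap, Matrix.J, Matrix.mul_apply, Matrix.one_apply,
      Matrix.toBlocks₁₁, Matrix.toBlocks₁₂, Matrix.toBlocks₂₁, Matrix.toBlocks₂₂]

theorem theta_matUnit {n m : ℕ} (i j : Idx n m) :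
    theta (matUnit i j) = thetaCoeff (pairSwap Finset.univ j) (pairSwap Finset.univ i) •
      matUnit (pairSwap Finset.univ j) (pairSwap Finset.univ i) := by
  ext a b
  rw [theta_apply, Matrix.smul_apply, smul_eq_mul]
  by_cases h : pairSwap Finset.univ j = a ∧ pairSwap Finset.univ i = b
  · obtain ⟨rfl, rfl⟩ := h
    simp [matUnit, pairSwap_pairSwap]
  · have h' : ¬ (i = pairSwap Finset.univ b ∧ j = pairSwap Finset.univ a) := by
      rintro ⟨rfl, rfl⟩
      exact h ⟨pairSwap_pairSwap _ _, pairSwap_pairSwap _ _⟩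
    rw [matUnit, matUnit, Matrix.single_apply_of_ne _ _ _ _ _ h,
      Matrix.single_apply_of_ne _ _ _ _ _ h', mul_zero, mul_zero]

theorem thetaCoeff_self {n m : ℕ} (i : Idx n m) : thetaCoeff i i = -1 := by
  rcases i with i | a | a <;> rfl

namespace GLModule

variable {n m : ℕ} {U : Type*} [AddCommGroup U] [Module ℂ U]

/-! ### Highest weight vectors and simple even reflections -/

theorem act_act_even (M : GLModule n m U) {p : ZMod 2} {x y : Gl n m} (hx : x ∈ glGr n m p)
    (hy : y ∈ glGr n m 0) (u : U) :
    M.act x (M.act y u) = M.act (x * y - y * x) u + M.act y (M.act x u) := by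
  rw [M.act_act hx hy]
  simp [sbracket]

/-- Reflection in an even simple root: E_ij, E_ji and E_ii - E_jj act as an sl₂, and the new highest
weight vector is the last nonzero vector f^k v of the string through v. -/
theorem IsHighest.exists_swap [FiniteDimensional ℂ U] {M : GLModule n m U} {r : Idx n m → ℤ}
    (hr : Function.Injective r) {wt : Idx n m → ℂ} {ε : ℂ} {v : U} (hv : M.IsHighest r wt ε v)
    {i j : Idx n m} (hij : r j = r i + 1) (hp : idxPar i = idxPar j) :
    ∃ v', M.IsHighest (r ∘ Equiv.swap i j) (wt ∘ Equiv.swap i j) ε v' := by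
  have hne : i ≠ j := by rintro rfl; omega
  have hf0 : matUnit j i ∈ glGr n m 0 := by
    have h := matUnit_mem j i
    rwa [hp, zmod_two_add_self] at h
  have he0 : matUnit i j ∈ glGr n m 0 := by
    have h := matUnit_mem i j
    rwa [hp, zmod_two_add_self] at h
  set f := M.act (matUnit j i) with hf
  set e := M.act (matUnit i j) with he
  set h := M.act (matUnit i i) - M.act (matUnit j j) with hh
  have hef : e * f - f * e = h := by
    refine LinearMap.ext fun u => ?_
    have := M.act_act_even he0 hf0 u
    rw [matUnit_mul_same, matUnit_mul_same] at this
    simp [hf, he, hh, this]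
  have hhe : h * e - e * h = (2 : ℂ) • e := by
    refine LinearMap.ext fun u => ?_
    simp only [he, hh, LinearMap.sub_apply, Module.End.mul_apply, LinearMap.smul_apply, map_sub,
      M.act_diag_comm]
    simp only [hne.symm, if_true, if_false]
    module
  have hhf : h * f - f * h = -((2 : ℂ) • f) := by
    refine LinearMap.ext fun u => ?_
    simp only [hf, hh, LinearMap.sub_apply, Module.End.mul_apply, LinearMap.smul_apply, map_sub,
      LinearMap.neg_apply, M.act_diag_comm]
    simp only [hne, if_true, if_false]
    module
  obtain ⟨k, hk, hk0, hk1⟩ := exists_nat_of_sl2 hef hhe hhf hv.ne_zero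
    (hv.raise i j (by omega)) (c := wt i - wt j) (by simp [hh, hv.weight, sub_smul])
  have hpar : ∀ t : ℕ, M.par ((f ^ t) v) = ε • (f ^ t) v := by
    intro t
    induction t with
    | zero => simpa using hv.par
    | succ t ih =>
      rw [pow_succ', Module.End.mul_apply, hf, M.par_act hf0, ← hf, ih]
      simp
  have hwt : ∀ (t : ℕ) (p : Idx n m), M.act (matUnit p p) ((f ^ t) v) =
      (wt p + t * ((if p = j then 1 else 0) - (if i = p then 1 else 0))) • (f ^ t) v := by
    intro t p
    induction t with
    | zero => simpa using hv.weight p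
    | succ t ih =>
      rw [pow_succ', Module.End.mul_apply, hf, M.act_diag_comm, ← hf, ih]
      rw [map_smul, ← add_smul]
      congr 1
      push_cast
      ring
  -- Commuting E_pq past f = E_ji gives only raising operators of the same kind or zero. Since i and
  -- j are consecutive, E_pi and E_jq are still raising once (p,q) ≠ (i,j).
  have hraise : ∀ (t : ℕ) (p q : Idx n m), r p < r q → ¬ (p = i ∧ q = j) →
      M.act (matUnit p q) ((f ^ t) v) = 0 := by
    intro t
    induction t with
    | zero => intro p q hpq _; simpa using hv.raise p q hpq
    | succ t ih =>
      intro p q hpq hpq'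
      rw [pow_succ', Module.End.mul_apply, hf, M.act_act_even (matUnit_mem p q) hf0, ← hf,
        ih p q hpq hpq', map_zero, add_zero]
      have h1 : M.act (matUnit p q * matUnit j i) ((f ^ t) v) = 0 := by
        by_cases hq : q = j
        · subst hq
          rw [matUnit_mul_same]
          have hpi : r p ≠ r i := fun h' => hpq' ⟨hr h', rfl⟩
          exact ih p i (by omega) (fun h' => hne h'.2)
        · rw [matUnit_mul_of_ne hq, map_zero, LinearMap.zero_apply]
      have h2 : M.act (matUnit j i * matUnit p q) ((f ^ t) v) = 0 := by
        by_cases hq : i = p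
        · subst hq
          rw [matUnit_mul_same]
          have hqj : r q ≠ r j := fun h' => hpq' ⟨rfl, hr h'⟩
          exact ih j q (by omega) (fun h' => hne h'.1.symm)
        · rw [matUnit_mul_of_ne hq, map_zero, LinearMap.zero_apply]
      rw [map_sub, LinearMap.sub_apply, h1, h2, sub_zero]
  refine ⟨(f ^ k) v, hk0, hpar k, fun p q hpq => ?_, fun p => ?_⟩
  · simp only [Function.comp_apply] at hpq
    -- The only raising operator new to the swapped ordering is f itself, which kills the end of the
    -- string.
    by_cases hji : p = j ∧ q = i
    · obtain ⟨rfl, rfl⟩ := hji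
      rw [pow_succ', Module.End.mul_apply] at hk1
      exact hk1
    · refine hraise k p q ?_ ?_
      -- Any other pair has the same order before and after the swap, because no rank lies between
      -- those of i and j.
      · by_contra hcon
        rcases eq_or_ne p i with rfl | hpi
        · rw [Equiv.swap_apply_left] at hpq
          rcases eq_or_ne q j with rfl | hqj
          · rw [Equiv.swap_apply_right] at hpq; omega
          · rcases eq_or_ne q p with rfl | hqi
            · simp at hpq
            · rw [Equiv.swap_apply_of_ne_of_ne hqi hqj] at hpq; omega
        · rcases eq_or_ne p j with rfl | hpj
          · rw [Equiv.swap_apply_right] at hpq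
            rcases eq_or_ne q i with rfl | hqi
            · exact hji ⟨rfl, rfl⟩
            · rcases eq_or_ne q p with rfl | hqj
              · simp at hpq
              · rw [Equiv.swap_apply_of_ne_of_ne hqi hqj] at hpq
                have := hr.ne hqj
                omega
          · rw [Equiv.swap_apply_of_ne_of_ne hpi hpj] at hpq
            rcases eq_or_ne q i with rfl | hqi
            · rw [Equiv.swap_apply_left] at hpq
              have := hr.ne hpi
              have := hr.ne hpj
              omega
            · rcases eq_or_ne q j with rfl | hqj
              · rw [Equiv.swap_apply_right] at hpq
                omega
              · rw [Equiv.swap_apply_of_ne_of_ne hqi hqj] at hpq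
                omega
      · rintro ⟨rfl, rfl⟩
        rw [Equiv.swap_apply_left, Equiv.swap_apply_right] at hpq
        omega
  -- Since k = wt i - wt j, moving k units of weight from i to j exchanges the two entries.
  · rw [hwt, Function.comp_apply]
    congr 1
    rw [← hk]
    rcases eq_or_ne p i with rfl | hpi
    · simp [hne]
    · rcases eq_or_ne p j with rfl | hpj
      · simp [hne]
      · rw [Equiv.swap_apply_of_ne_of_ne hpi hpj]
        simp [hpj, hpi.symm]

/-- One even simple reflection per pair: a pair not yet swapped is still adjacent in the current
ordering. -/
theorem IsHighest.exists_pairSwap [FiniteDimensional ℂ U] {M : GLModule n m U}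
    {wt : Idx n m → ℂ} {ε : ℂ} {v : U} (hv : M.IsHighest rank wt ε v) (T : Finset (Fin m)) :
    ∃ v', M.IsHighest (rank ∘ pairSwap T) (wt ∘ pairSwap T) ε v' := by
  induction T using Finset.induction_on with
  | empty =>
    have : (pairSwap ∅ : Idx n m → Idx n m) = id := by
      funext k; rcases k with i | a | a <;> simp [pairSwap]
    exact ⟨v, by simpa [this] using hv⟩
  | insert a T ha ih =>
    obtain ⟨w, hw⟩ := ih
    have := hw.exists_swap (rank_injective.comp (pairSwap_injective T))
      (i := .inr (.inl a)) (j := .inr (.inr a)) (by simp [pairSwap, ha, rank]) rfl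
    rw [pairSwap_insert ha]
    exact this

/-! ### The dual and the twisted module -/

theorem dual_par (M : GLModule n m U) (f : Module.Dual ℂ U) : M.dual.par f = f ∘ₗ M.par := by
  have h : M.dual.par = LinearMap.lcomp ℂ ℂ M.par := by
    refine M.dual.ext_hom fun i f hf => ?_
    rcases zmod_two_cases i with rfl | rfl
    · rw [M.dual.par_even hf]
      exact (M.dualGr_par_even hf).symm
    · rw [M.dual.par_odd hf]
      exact (M.dualGr_par_odd hf).symm
  rw [h]
  rfl

theorem dual_act_even (M : GLModule n m U) {x : Gl n m} (hx : x ∈ glGr n m 0)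
    (f : Module.Dual ℂ U) (u : U) : M.dual.act x f u = -f (M.act x u) := by
  have h : M.dual.act x f = _ := M.dualAction_even hx f
  rw [h]
  rfl

theorem dual_act_odd (M : GLModule n m U) {x : Gl n m} (hx : x ∈ glGr n m 1)
    (f : Module.Dual ℂ U) (u : U) : M.dual.act x f u = f (M.act x (M.par u)) := by
  have h : M.dual.act x f = _ := M.dualAction_odd hx f
  rw [h]
  change -f (M.par (M.act x u)) = _
  rw [M.par_act hx]
  simp

theorem dual_act_apply_eq_zero (M : GLModule n m U) {i : ZMod 2} {x : Gl n m}
    (hx : x ∈ glGr n m i) (f : Module.Dual ℂ U) {u : U} {ε : ℂ} (hu : M.par u = ε • u)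
    (h : M.act x u = 0) : M.dual.act x f u = 0 := by
  rcases zmod_two_cases i with rfl | rfl
  · rw [M.dual_act_even hx, h, map_zero, neg_zero]
  · rw [M.dual_act_odd hx, hu, map_smul, h, smul_zero, map_zero]

theorem apply_act_eq_zero (M : GLModule n m U) {i : ZMod 2} {x : Gl n m} (hx : x ∈ glGr n m i)
    {f : Module.Dual ℂ U} (hf : M.dual.act x f = 0) (u : U) : f (M.act x u) = 0 := by
  rcases zmod_two_cases i with rfl | rfl
  · have h := M.dual_act_even hx f u
    rw [hf] at h
    simpa using h.symm
  · have h := M.dual_act_odd hx f (M.par u)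
    rw [hf, par_par_apply] at h
    exact h.symm

theorem twist_par (M : GLModule n m U) : M.twist.par = M.par := rfl

theorem twist_act (M : GLModule n m U) (x : Gl n m) : M.twist.act x = M.act (theta x) := rfl

theorem IsIrreducible.twist {M : GLModule n m U} (hM : M.IsIrreducible) :
    M.twist.IsIrreducible := by
  refine ⟨hM.1, fun W h1 h2 => hM.2 W h1 fun x u hu => ?_⟩
  have h := h2 (theta x) u hu
  rwa [twist_act, theta_theta] at h

/-! ### Highest weight vectors of irreducible modules -/

theorem IsHighest.exists_stable_le_ker {M : GLModule n m U} {r : Idx n m → ℤ}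
    (hr : Function.Injective r) {wt : Idx n m → ℂ} {ε : ℂ} {v : U} (hv : M.IsHighest r wt ε v)
    (f : U →ₗ[ℂ] ℂ) (hfv : f v = 0)
    (hf : ∀ i j, r j < r i → ∀ u, f (M.act (matUnit i j) u) = 0) :
    ∃ W : Submodule ℂ U, M.Stable W ∧ (∀ u ∈ W, M.par u ∈ W) ∧ v ∈ W ∧ ∀ u ∈ W, f u = 0 := by
  refine M.exists_stable_le_ker (A := {x | ∃ i j, r j < r i ∧ x = matUnit i j})
    (B := {x | ∃ i j, r i ≤ r j ∧ x = matUnit i j}) ?_ ?_ ?_ hv.par ?_ f hfv ?_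
  · rintro _ ⟨i, j, -, rfl⟩
    exact ⟨_, matUnit_mem i j⟩
  · rintro _ ⟨i, j, -, rfl⟩
    exact ⟨_, matUnit_mem i j⟩
  · refine mem_span_matUnit _ fun i j => Submodule.subset_span ?_
    rcases lt_or_ge (r j) (r i) with h | h
    · exact Or.inl ⟨i, j, h, rfl⟩
    · exact Or.inr ⟨i, j, h, rfl⟩
  · rintro _ ⟨i, j, hij, rfl⟩
    rcases hij.lt_or_eq with h | h
    · exact ⟨0, by rw [hv.raise i j h, zero_smul]⟩
    · obtain rfl := hr h
      exact ⟨_, hv.weight i⟩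
  · rintro _ ⟨i, j, hij, rfl⟩ u
    exact hf i j hij u

theorem IsHighest.apply_act {M : GLModule n m U} {r : Idx n m → ℤ} {wt : Idx n m → ℂ} {ε : ℂ}
    {l : Module.Dual ℂ U} (hl : M.dual.IsHighest (-r) wt ε l) (i j : Idx n m) (hij : r j < r i)
    (u : U) : l (M.act (matUnit i j) u) = 0 :=
  M.apply_act_eq_zero (matUnit_mem i j) (hl.raise i j (by simpa using hij)) u

/-- The functional l vanishes on the images of all lowering operators. If it also vanished at v, it
would vanish on the submodule generated by v, which is U. -/
theorem IsHighest.apply_ne_zero {M : GLModule n m U} (hM : M.IsIrreducible) {r : Idx n m → ℤ}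
    (hr : Function.Injective r) {wt wt' : Idx n m → ℂ} {ε ε' : ℂ} {v : U}
    {l : Module.Dual ℂ U} (hv : M.IsHighest r wt ε v) (hl : M.dual.IsHighest (-r) wt' ε' l) :
    l v ≠ 0 := by
  intro h0
  obtain ⟨W, hW, -, hvW, hker⟩ := hv.exists_stable_le_ker hr l h0 hl.apply_act
  have htop := hM.eq_top_of_mem hW hv.ne_zero hv.par hvW
  exact hl.ne_zero (LinearMap.ext fun u => hker u (by rw [htop]; trivial))

/-- Evaluate at v, where l is nonzero, and compare the diagonal and parity operators on both sides
of the pairing. -/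
theorem IsHighest.dual_weight {M : GLModule n m U} {r : Idx n m → ℤ}
    {wt wt' : Idx n m → ℂ} {ε ε' : ℂ} {v : U}
    {l : Module.Dual ℂ U} (hv : M.IsHighest r wt ε v) (hl : M.dual.IsHighest (-r) wt' ε' l)
    (hlv : l v ≠ 0) : (∀ i, wt' i = -wt i) ∧ ε' = ε := by
  constructor
  · intro i
    have h := M.dual_act_even (matUnit_self_mem i) l v
    rw [hl.weight, hv.weight, map_smul, LinearMap.smul_apply, smul_eq_mul, smul_eq_mul,
      ← neg_mul] at h
    exact mul_right_cancel₀ hlv h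
  · have h := LinearMap.congr_fun (M.dual_par l) v
    rw [hl.par, LinearMap.comp_apply, hv.par, map_smul, LinearMap.smul_apply] at h
    exact mul_right_cancel₀ hlv h

/-- A highest weight vector of `U` for the ordering `rank` is a highest weight vector of `U^θ`. -/
theorem IsHighest.twist {M : GLModule n m U} {wt : Idx n m → ℂ} {ε : ℂ} {v : U}
    (hv : M.IsHighest rank wt ε v) :
    M.twist.IsHighest (-(rank ∘ pairSwap Finset.univ)) (fun i => -wt (pairSwap Finset.univ i)) ε
      v where
  ne_zero := hv.ne_zero
  par := hv.par
  raise i j hij := by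
    rw [twist_act, theta_matUnit, map_smul, LinearMap.smul_apply, hv.raise _ _ ?_, smul_zero]
    simpa using hij
  weight i := by
    rw [twist_act, theta_matUnit, map_smul, LinearMap.smul_apply, hv.weight, thetaCoeff_self,
      smul_smul, neg_one_mul]

/-- Schur's lemma: an operator commuting with the action on an irreducible finite-dimensional module
is a scalar, even if it is not homogeneous. -/
theorem IsIrreducible.exists_eq_smul [FiniteDimensional ℂ U] {M : GLModule n m U}
    (hM : M.IsIrreducible) (T : Module.End ℂ U) (hT : ∀ x u, T (M.act x u) = M.act x (T u)) :
    ∃ c : ℂ, ∀ u, T u = c • u := by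
  have := hM.1
  obtain ⟨wt, ε, v, hv⟩ := M.exists_isHighest rank
  obtain ⟨wt', ε', l, hl⟩ := M.dual.exists_isHighest (-rank)
  have hlv := hv.apply_ne_zero hM rank_injective hl
  -- Uniqueness of the highest weight vector: a homogeneous one at which l vanishes must be zero.
  have key : ∀ w : U, (∀ δ : ℂ, M.par w = δ • w → l w = 0 →
      (∀ i j, rank i < rank j → M.act (matUnit i j) w = 0) →
      (∀ i, M.act (matUnit i i) w = wt i • w) → w = 0) := by
    intro w δ h1 h2 h3 h4
    by_contra hw
    exact (IsHighest.mk hw h1 h3 h4).apply_ne_zero hM rank_injective hl h2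
  -- The scalar is forced by requiring l to vanish on `T v - c • v`. An eigenvalue of T would not do
  -- directly, as its eigenspace need not be graded when T is not homogeneous.
  set c := l (T v) / l v with hc
  set w := T v - c • v with hw
  have hlw : l w = 0 := by
    rw [hw, map_sub, map_smul, smul_eq_mul, hc, div_mul_cancel₀ _ hlv, sub_self]
  have hwr : ∀ i j, rank i < rank j → M.act (matUnit i j) w = 0 := by
    intro i j hij
    rw [hw, map_sub, map_smul, ← hT, hv.raise i j hij, map_zero, smul_zero, sub_zero]
  have hww : ∀ i, M.act (matUnit i i) w = wt i • w := by
    intro i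
    rw [hw, map_sub, map_smul, ← hT, hv.weight, map_smul, smul_sub, smul_comm]
  have hpr : ∀ i j, rank i < rank j → M.act (matUnit i j) (M.par w) = 0 := by
    intro i j hij
    have h := M.par_act (matUnit_mem i j) w
    rw [hwr i j hij, map_zero, eq_comm, smul_eq_zero] at h
    exact h.resolve_left (sgn_ne_zero _ _)
  have hpw : ∀ i, M.act (matUnit i i) (M.par w) = wt i • M.par w := by
    intro i
    have h := M.par_act (matUnit_self_mem i) w
    rw [hww i, map_smul, sgn_zero_left, one_smul] at h
    exact h.symm
  have hlp : l (M.par w) = 0 := by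
    have h := LinearMap.congr_fun (M.dual_par l) w
    rw [hl.par, LinearMap.smul_apply, hlw, smul_zero] at h
    exact h.symm
  -- `w` may mix parities, so uniqueness is applied to twice its even part and then to twice its odd
  -- part.
  have hplus : w + M.par w = 0 := by
    refine key _ 1 ?_ (by rw [map_add, hlw, hlp, add_zero]) ?_ ?_
    · rw [map_add, par_par_apply, one_smul, add_comm]
    · intro i j hij
      rw [map_add, hwr i j hij, hpr i j hij, add_zero]
    · intro i
      rw [map_add, hww, hpw, ← smul_add]
  have hminus : w - M.par w = 0 := by
    refine key _ (-1) ?_ (by rw [map_sub, hlw, hlp, sub_zero]) ?_ ?_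
    · rw [map_sub, par_par_apply, neg_one_smul, neg_sub]
    · intro i j hij
      rw [map_sub, hwr i j hij, hpr i j hij, sub_zero]
    · intro i
      rw [map_sub, hww, hpw, ← smul_sub]
  have hw0 : w = 0 := by
    have e : w = (2 : ℂ)⁻¹ • ((w + M.par w) + (w - M.par w)) := by module
    rw [e, hplus, hminus, add_zero, smul_zero]
  have hTv : T v = c • v := sub_eq_zero.mp (hw ▸ hw0)
  have htop : LinearMap.ker (T - c • LinearMap.id) = ⊤ := by
    refine hM.eq_top_of_mem ?_ hv.ne_zero hv.par (by simp [hTv])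
    intro x u hu
    have hu' : T u - c • u = 0 := by simpa using hu
    change T (M.act x u) - c • M.act x u = 0
    rw [hT, ← map_smul, ← map_sub, hu', map_zero]
  refine ⟨c, fun u => ?_⟩
  have hu : u ∈ LinearMap.ker (T - c • LinearMap.id) := by rw [htop]; trivial
  have hu' : T u - c • u = 0 := by simpa using hu
  exact sub_eq_zero.mp hu'

/-! ### The isomorphism of the twisted and the dual module -/

/-- The direct sum of two modules. -/
def prod {U' : Type*} [AddCommGroup U'] [Module ℂ U'] (M : GLModule n m U)
    (M' : GLModule n m U') : GLModule n m (U × U') where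
  gr i := (M.gr i).prod (M'.gr i)
  isCompl := by
    constructor
    · rw [disjoint_iff, Submodule.prod_inf_prod, M.isCompl.inf_eq_bot, M'.isCompl.inf_eq_bot,
        Submodule.prod_bot]
    · rw [codisjoint_iff, Submodule.prod_sup_prod, M.isCompl.sup_eq_top, M'.isCompl.sup_eq_top,
        Submodule.prod_top]
  act :=
    { toFun := fun x => (M.act x).prodMap (M'.act x)
      map_add' := fun x y => by ext <;> simp
      map_smul' := fun c x => by ext <;> simp }
  act_mem i j x hx u hu := ⟨M.act_mem i j x hx _ hu.1, M'.act_mem i j x hx _ hu.2⟩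
  act_sbracket i j x y hx hy := by
    refine LinearMap.ext fun u => Prod.ext ?_ ?_
    · change M.act _ u.1 = _
      rw [M.act_sbracket i j x y hx hy]
      simp [sbracket]
    · change M'.act _ u.2 = _
      rw [M'.act_sbracket i j x y hx hy]
      simp [sbracket]

theorem prod_act {U' : Type*} [AddCommGroup U'] [Module ℂ U'] (M : GLModule n m U)
    (M' : GLModule n m U') (x : Gl n m) (u : U × U') :
    (M.prod M').act x u = (M.act x u.1, M'.act x u.2) := rfl

theorem prod_par {U' : Type*} [AddCommGroup U'] [Module ℂ U'] (M : GLModule n m U)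
    (M' : GLModule n m U') (u : U × U') :
    (M.prod M').par u = (M.par u.1, M'.par u.2) := by
  have h : (M.prod M').par = M.par.prodMap M'.par := by
    refine (M.prod M').ext_hom fun i u hu => ?_
    have h1 := ((M.prod M').mem_gr_iff_par i u).mp hu
    have h2 := (M.mem_gr_iff_par i u.1).mp hu.1
    have h3 := (M'.mem_gr_iff_par i u.2).mp hu.2
    rw [h1, LinearMap.prodMap_apply, h2, h3]
    rfl
  rw [h]
  rfl

theorem IsHighest.prod {U' : Type*} [AddCommGroup U'] [Module ℂ U'] {M : GLModule n m U}
    {M' : GLModule n m U'} {r : Idx n m → ℤ} {wt : Idx n m → ℂ} {ε : ℂ} {v : U} {v' : U'}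
    (hv : M.IsHighest r wt ε v) (hv' : M'.IsHighest r wt ε v') :
    (M.prod M').IsHighest r wt ε (v, v') where
  ne_zero h := hv.ne_zero (congrArg Prod.fst h)
  par := by rw [prod_par, hv.par, hv'.par]; rfl
  raise i j hij := by rw [prod_act, hv.raise i j hij, hv'.raise i j hij]; rfl
  weight i := by rw [prod_act, hv.weight, hv'.weight]; rfl

/-- Two irreducible modules with equal highest weight and parity are isomorphic, by a Goursat
argument on the submodule `S` of the direct sum generated by the pair of highest weight vectors. -/
theorem IsIrreducible.twist_isIsomorphic_dual [FiniteDimensional ℂ U] {M : GLModule n m U}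
    (hM : M.IsIrreducible) : M.twist.IsIsomorphic M.dual := by
  have := hM.1
  obtain ⟨wt, ε, v, hv⟩ := M.exists_isHighest rank
  obtain ⟨v', hv'⟩ := hv.exists_pairSwap Finset.univ
  set r : Idx n m → ℤ := rank ∘ pairSwap Finset.univ with hr
  have hrinj : Function.Injective r := rank_injective.comp (pairSwap_injective _)
  have hrneg : Function.Injective (-r) := neg_injective.comp hrinj
  obtain ⟨wt₁, ε₁, l, hl⟩ := M.dual.exists_isHighest (-r)
  have hlv' := hv'.apply_ne_zero hM hrinj hl
  obtain ⟨hwt₁, rfl⟩ := hv'.dual_weight hl hlv'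
  have htw := hv.twist
  rw [← hr] at htw
  have hl' : M.dual.IsHighest (-r) (fun i => -wt (pairSwap Finset.univ i)) ε₁ l := by
    have e : wt₁ = fun i => -wt (pairSwap Finset.univ i) := funext hwt₁
    rwa [← e]
  obtain ⟨wt₂, ε₂, k, hk⟩ := M.twist.dual.exists_isHighest (- -r)
  have hkv := htw.apply_ne_zero hM.twist hrneg hk
  -- Both k and evaluation at v' kill the images of the lowering operators. This combination is
  -- scaled to vanish at (v, l) too, so it vanishes on all of `S`.
  obtain ⟨S, hS, hSp, hvS, hSker⟩ := (htw.prod hl').exists_stable_le_ker hrneg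
    ((l v') • (k ∘ₗ LinearMap.fst ℂ U (Module.Dual ℂ U)) -
      (k v) • (Module.Dual.eval ℂ U v' ∘ₗ LinearMap.snd ℂ U (Module.Dual ℂ U)))
    (by
      simp only [LinearMap.sub_apply, LinearMap.smul_apply, LinearMap.comp_apply,
        LinearMap.fst_apply, LinearMap.snd_apply, Module.Dual.eval_apply, smul_eq_mul]
      ring)
    (by
      intro i j hij u
      have h1 := hk.apply_act i j hij u.1
      have h2 : M.dual.act (matUnit i j) u.2 v' = 0 :=
        M.dual_act_apply_eq_zero (matUnit_mem i j) u.2 hv'.par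
          (hv'.raise i j (by simpa using hij))
      simp only [LinearMap.sub_apply, LinearMap.smul_apply, LinearMap.comp_apply,
        LinearMap.fst_apply, LinearMap.snd_apply, Module.Dual.eval_apply, prod_act, h1, h2,
        smul_zero, sub_zero])
  have hfst : S.map (LinearMap.fst ℂ U (Module.Dual ℂ U)) = ⊤ := by
    refine hM.twist.eq_top_of_mem ?_ htw.ne_zero htw.par ⟨_, hvS, rfl⟩
    rintro x _ ⟨u, hu, rfl⟩
    exact ⟨_, hS x u hu, rfl⟩
  -- If (0, g) ∈ `S`, the linear relation on `S` gives g(v') = 0, since k(v) ≠ 0. The common zeros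
  -- of all such g form a graded submodule containing v', hence all of U.
  have hsnd : ∀ g : Module.Dual ℂ U, ((0 : U), g) ∈ S → g = 0 := by
    let W : Submodule ℂ U := ⨅ g : {g : Module.Dual ℂ U // ((0 : U), g) ∈ S}, LinearMap.ker g.1
    have memW : ∀ u, u ∈ W ↔ ∀ g : Module.Dual ℂ U, ((0 : U), g) ∈ S → g u = 0 := by
      intro u
      simp [W, Submodule.mem_iInf]
    have hact : ∀ (x : Gl n m) (g : Module.Dual ℂ U), ((0 : U), g) ∈ S →
        ((0 : U), M.dual.act x g) ∈ S := by
      intro x g hg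
      have h := hS x _ hg
      rw [prod_act] at h
      simpa using h
    have hWp : ∀ u ∈ W, M.par u ∈ W := by
      intro u hu
      rw [memW] at hu ⊢
      intro g hg
      have h := hSp _ hg
      rw [prod_par] at h
      simp only [map_zero] at h
      have h2 := hu _ h
      rwa [M.dual_par] at h2
    have hWs : M.Stable W := by
      refine M.stable_of_homogeneous fun i x hx u hu => ?_
      rw [memW]
      intro g hg
      rcases zmod_two_cases i with rfl | rfl
      · have h := (memW u).mp hu _ (hact x g hg)
        rw [M.dual_act_even hx] at h
        exact neg_eq_zero.mp h
      · have h := (memW _).mp (hWp u hu) _ (hact x g hg)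
        rwa [M.dual_act_odd hx, par_par_apply] at h
    have hWtop : W = ⊤ := by
      refine hM.eq_top_of_mem hWs hv'.ne_zero hv'.par ((memW v').mpr fun g hg => ?_)
      have h := hSker _ hg
      simp only [LinearMap.sub_apply, LinearMap.smul_apply, LinearMap.comp_apply,
        LinearMap.fst_apply, LinearMap.snd_apply, Module.Dual.eval_apply, map_zero, mul_zero,
        zero_sub, neg_eq_zero, smul_eq_mul] at h
      exact (mul_eq_zero.mp h).resolve_left hkv
    intro g hg
    refine LinearMap.ext fun u => (memW u).mp (by rw [hWtop]; trivial) g hg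
  let p : S →ₗ[ℂ] U := LinearMap.fst ℂ U (Module.Dual ℂ U) ∘ₗ S.subtype
  have hpbij : Function.Bijective p := by
    constructor
    · rw [injective_iff_map_eq_zero]
      rintro ⟨⟨u, g⟩, hug⟩ h0
      have h0' : u = 0 := h0
      subst h0'
      have := hsnd g hug
      subst this
      rfl
    · intro u
      have hu : u ∈ S.map (LinearMap.fst ℂ U (Module.Dual ℂ U)) := by rw [hfst]; trivial
      obtain ⟨w, hw, rfl⟩ := hu
      exact ⟨⟨w, hw⟩, rfl⟩
  let e := LinearEquiv.ofBijective p hpbij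
  let T : U →ₗ[ℂ] Module.Dual ℂ U :=
    LinearMap.snd ℂ U (Module.Dual ℂ U) ∘ₗ S.subtype ∘ₗ e.symm.toLinearMap
  have hT : ∀ u g, (u, g) ∈ S → T u = g := by
    intro u g hug
    have : e.symm u = ⟨(u, g), hug⟩ := by
      rw [LinearEquiv.symm_apply_eq]
      rfl
    simp [T, this]
  have hTmem : ∀ u, (u, T u) ∈ S := by
    intro u
    have h1 : ((e.symm u : U × Module.Dual ℂ U)).1 = u := e.apply_symm_apply u
    have h2 : (u, T u) = (e.symm u : U × Module.Dual ℂ U) := Prod.ext h1.symm rfl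
    rw [h2]
    exact (e.symm u).2
  have hTact : ∀ x u, T (M.twist.act x u) = M.dual.act x (T u) := fun x u =>
    hT _ _ (hS x _ (hTmem u))
  have hTpar : ∀ u, T (M.par u) = M.dual.par (T u) := by
    intro u
    have h := hSp _ (hTmem u)
    rw [prod_par] at h
    exact hT _ _ h
  have hTinj : LinearMap.ker T = ⊥ := by
    refine (hM.twist.eq_bot_or_eq_top (W := LinearMap.ker T) ?_ ?_).resolve_right ?_
    · intro x u hu
      rw [LinearMap.mem_ker] at hu ⊢
      rw [hTact, hu, map_zero]
    · intro u hu
      rw [LinearMap.mem_ker] at hu ⊢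
      rw [twist_par, hTpar, hu, map_zero]
    · intro htop
      have : v ∈ LinearMap.ker T := by rw [htop]; trivial
      rw [LinearMap.mem_ker, hT v l hvS] at this
      exact hl.ne_zero this
  refine ⟨LinearEquiv.ofInjectiveOfFinrankEq T (LinearMap.ker_eq_bot.mp hTinj)
    (Subspace.dual_finrank_eq).symm, fun i u hu => ?_, fun x u => ?_⟩
  · rw [M.dual.mem_gr_iff_par]
    change M.dual.par (T u) = sgn i 1 • T u
    rw [← hTpar, (M.mem_gr_iff_par i u).mp hu, map_smul]
  · exact hTact x u

end GLModule

/-! ### The enveloping algebra -/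

theorem ug_induction {n m : ℕ} {P : Ug n m → Prop} (hone : P 1)
    (hsmul : ∀ (c : ℂ) (w), P w → P (c • w))
    (hadd : ∀ a b, P a → P b → P (a + b))
    (hmul : ∀ i, ∀ x ∈ glGr n m i, ∀ w, P w → P (ugι x * w)) (w : Ug n m) : P w := by
  obtain ⟨t, rfl⟩ : ∃ t, ugMk n m t = w := Quotient.exists_rep w
  have key : ∀ w, P w → P (ugMk n m t * w) := by
    induction t using TensorAlgebra.induction with
    | algebraMap c =>
      intro w hw
      rw [AlgHom.commutes, ← Algebra.smul_def]
      exact hsmul c w hw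
    | ι x =>
      intro w hw
      change P (ugι x * w)
      rw [← glProj_add x, map_add, add_mul]
      exact hadd _ _ (hmul 0 _ (glProj_mem 0 x) w hw) (hmul 1 _ (glProj_mem 1 x) w hw)
    | mul a b ha hb =>
      intro w hw
      rw [map_mul, mul_assoc]
      exact ha _ (hb _ hw)
    | add a b ha hb =>
      intro w hw
      rw [map_add, add_mul]
      exact hadd _ _ (ha _ hw) (hb _ hw)
  have h := key 1 hone
  rwa [mul_one] at h

theorem ugT_add {n m : ℕ} (a b : Ug n m) : ugT (a + b) = ugT a + ugT b := by
  simp [ugT]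

theorem ugT_smul {n m : ℕ} (c : ℂ) (a : Ug n m) : ugT (c • a) = c • ugT a := by
  simp [ugT]

/-- `ugT` is constructed from left multiplication by generators; its rule for a right factor needs
an induction on words. -/
theorem ugT_mul_ugι_even {n m : ℕ} {y : Gl n m} (hy : y ∈ glGr n m 0) (w : Ug n m) :
    ugT (w * ugι y) = -(ugι y * ugT w) := by
  induction w using ug_induction with
  | hone => rw [one_mul, ugT_ugι, ugT_one, mul_one]
  | hsmul c w hw => rw [smul_mul_assoc, ugT_smul, hw, ugT_smul, mul_smul_comm, smul_neg]
  | hadd a b ha hb => rw [add_mul, ugT_add, ha, hb, ugT_add, mul_add, neg_add]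
  | hmul i x hx w hw =>
    rcases zmod_two_cases i with rfl | rfl
    · rw [mul_assoc, ugT_ugι_mul_even hx, hw, ugT_ugι_mul_even hx, neg_mul, mul_assoc]
    · rw [mul_assoc, ugT_ugι_mul_odd hx, hw, ugT_ugι_mul_odd hx, map_neg, map_mul,
        ugPar_ugι_even hy, neg_mul, mul_assoc]

theorem ugT_mul_ugι_odd {n m : ℕ} {y : Gl n m} (hy : y ∈ glGr n m 1) (w : Ug n m) :
    ugT (w * ugι y) = -(ugι y * ugPar (ugT w)) := by
  induction w using ug_induction with
  | hone => rw [one_mul, ugT_ugι, ugT_one, map_one, mul_one]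
  | hsmul c w hw =>
    rw [smul_mul_assoc, ugT_smul, hw, ugT_smul, map_smul, mul_smul_comm, smul_neg]
  | hadd a b ha hb => rw [add_mul, ugT_add, ha, hb, ugT_add, map_add, mul_add, neg_add]
  | hmul i x hx w hw =>
    rcases zmod_two_cases i with rfl | rfl
    · rw [mul_assoc, ugT_ugι_mul_even hx, hw, ugT_ugι_mul_even hx, ugT_ugι, map_mul, map_neg,
        ugPar_ugι_even hx, neg_mul, mul_assoc]
    · rw [mul_assoc, ugT_ugι_mul_odd hx, hw, ugT_ugι_mul_odd hx, ugT_ugι, map_mul, map_neg,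
        map_neg, map_mul, ugPar_ugι_odd hy, ugPar_ugι_odd hx, ugPar_ugPar]
      simp [mul_assoc]

theorem mem_center_of_commute_ugι {n m : ℕ} {z : Ug n m}
    (h : ∀ i, ∀ x ∈ glGr n m i, ugι x * z = z * ugι x) : z ∈ Subalgebra.center ℂ (Ug n m) := by
  rw [Subalgebra.mem_center_iff]
  intro w
  induction w using ug_induction with
  | hone => rw [one_mul, mul_one]
  | hsmul c w hw => rw [smul_mul_assoc, hw, mul_smul_comm]
  | hadd a b ha hb => rw [add_mul, ha, hb, mul_add]
  | hmul i x hx w hw => rw [mul_assoc, hw, ← mul_assoc, h i x hx, mul_assoc]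

theorem ugPar_mem_center {n m : ℕ} {z : Ug n m} (hz : z ∈ Subalgebra.center ℂ (Ug n m)) :
    ugPar z ∈ Subalgebra.center ℂ (Ug n m) := by
  rw [Subalgebra.mem_center_iff] at hz ⊢
  intro w
  have h := congrArg ugPar (hz (ugPar w))
  rwa [map_mul, map_mul, ugPar_ugPar] at h

theorem ugComp_mem_center {n m : ℕ} (i : ZMod 2) {z : Ug n m}
    (hz : z ∈ Subalgebra.center ℂ (Ug n m)) : ugComp i z ∈ Subalgebra.center ℂ (Ug n m) :=
  Subalgebra.smul_mem _ (Subalgebra.add_mem _ hz (Subalgebra.smul_mem _ (ugPar_mem_center hz) _)) _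

/-- Applying `ugT` to x z = z x for odd x shows that `ugPar (ugT z)`, rather than `ugT z`, commutes
with x. For even x either commutes, and `ugPar` preserves the centre. -/
theorem ugT_mem_center {n m : ℕ} {z : Ug n m} (hz : z ∈ Subalgebra.center ℂ (Ug n m)) :
    ugT z ∈ Subalgebra.center ℂ (Ug n m) := by
  have key : ugPar (ugT z) ∈ Subalgebra.center ℂ (Ug n m) := by
    rw [Subalgebra.mem_center_iff] at hz
    refine mem_center_of_commute_ugι fun i x hx => ?_
    have h := congrArg ugT (hz (ugι x))
    rcases zmod_two_cases i with rfl | rfl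
    · rw [ugT_ugι_mul_even hx, ugT_mul_ugι_even hx, ugT_ugι, mul_neg, neg_inj] at h
      have h' := congrArg ugPar h
      rw [map_mul, map_mul, ugPar_ugι_even hx] at h'
      exact h'.symm
    · rw [ugT_ugι_mul_odd hx, ugT_mul_ugι_odd hx, ugT_ugι, mul_neg, neg_inj] at h
      exact h.symm
  have h := ugPar_mem_center key
  rwa [ugPar_ugPar] at h

/-! ### The grading of `osp(n,2m)` -/

theorem theta_glProj {n m : ℕ} (i : ZMod 2) (x : Gl n m) :
    theta (glProj i x) = glProj i (theta x) := by
  have h0 := theta_mem (glProj_mem 0 x)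
  have h1 := theta_mem (glProj_mem 1 x)
  conv_rhs => rw [← glProj_add x, map_add, map_add]
  rcases zmod_two_cases i with rfl | rfl
  · rw [glProj_of_mem h0, glProj_of_mem_ne (by decide) h1, add_zero]
  · rw [glProj_of_mem h1, glProj_of_mem_ne (by decide) h0, zero_add]

theorem glProj_mem_osp {n m : ℕ} (i : ZMod 2) {x : Gl n m} (hx : x ∈ osp n m) :
    glProj i x ∈ osp n m := by
  have hx' : theta x = x := hx
  change theta (glProj i x) = glProj i x
  rw [theta_glProj, hx']

/-- The Iwasawa decomposition: `gl(n,2m)` is the sum of `osp(n,2m)` and a Borel subalgebra. -/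
theorem mem_span_osp_union_borel {n m : ℕ} (x : Gl n m) :
    x ∈ Submodule.span ℂ ({x | x ∈ osp n m ∧ ∃ i, x ∈ glGr n m i} ∪
      {x | ∃ i j : Idx n m, rank i ≤ rank j ∧ x = matUnit i j}) := by
  refine mem_span_matUnit _ (fun i j => ?_) x
  rcases lt_or_ge (rank j) (rank i) with h | h
  · rcases rank_pairSwap_lt h with h' | ⟨a, rfl, rfl⟩
    -- For a lowering x, the element x + θ(x) lies in 𝔨, and here θ(x) is a multiple of a raising
    -- matrix unit.
    · have e : matUnit i j = (matUnit i j + theta (matUnit i j)) - theta (matUnit i j) := by abel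
      rw [e]
      refine Submodule.sub_mem _ (Submodule.subset_span (Or.inl ⟨?_, idxPar i + idxPar j, ?_⟩)) ?_
      · change theta _ = _
        rw [map_add, theta_theta, add_comm]
      · exact Submodule.add_mem _ (matUnit_mem i j) (theta_mem (matUnit_mem i j))
      · rw [theta_matUnit]
        exact Submodule.smul_mem _ _ (Submodule.subset_span (Or.inr ⟨_, _, h'.le, rfl⟩))
    -- The remaining lowering units join the two members of one symplectic pair; they are fixed by
    -- θ.
    · refine Submodule.subset_span (Or.inl ⟨?_, _, matUnit_mem _ _⟩)
      change theta _ = _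
      rw [theta_matUnit]
      simp [pairSwap, thetaCoeff]
  · exact Submodule.subset_span (Or.inr ⟨i, j, h, rfl⟩)

namespace GLModule

variable {n m : ℕ} {U : Type*} [AddCommGroup U] [Module ℂ U]

/-! ### Invariant vectors -/

theorem mem_kInv_iff (M : GLModule n m U) (u : U) :
    u ∈ M.kInv ↔ ∀ x ∈ osp n m, M.act x u = 0 := Iff.rfl

theorem par_mem_kInv (M : GLModule n m U) {u : U} (hu : u ∈ M.kInv) : M.par u ∈ M.kInv := by
  rw [mem_kInv_iff] at hu ⊢
  intro x hx
  have h : ∀ i, M.act (glProj i x) (M.par u) = 0 := by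
    intro i
    have h := M.par_act (glProj_mem i x) u
    rw [hu _ (glProj_mem_osp i hx), map_zero, eq_comm, smul_eq_zero] at h
    exact h.resolve_left (sgn_ne_zero _ _)
  rw [← glProj_add x, map_add, LinearMap.add_apply, h 0, h 1, add_zero]

theorem apply_act_of_mem_kInv (M : GLModule n m U) {l : Module.Dual ℂ U} (hl : l ∈ M.dual.kInv)
    {x : Gl n m} (hx : x ∈ osp n m) (u : U) : l (M.act x u) = 0 := by
  have h : ∀ i, l (M.act (glProj i x) u) = 0 := fun i =>
    M.apply_act_eq_zero (glProj_mem i x) (hl _ (glProj_mem_osp i hx)) u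
  rw [← glProj_add x, map_add, LinearMap.add_apply, map_add, h 0, h 1, add_zero]

/-- Evaluation at a highest weight vector is injective on invariant functionals: 𝔤 is the sum of 𝔨
and a Borel subalgebra preserving the line of v, so a functional vanishing at v and on 𝔨U is zero.
-/
theorem IsIrreducible.finrank_dual_kInv_le_one [FiniteDimensional ℂ U] {M : GLModule n m U}
    (hM : M.IsIrreducible) : Module.finrank ℂ M.dual.kInv ≤ 1 := by
  have := hM.1
  obtain ⟨wt, ε, v, hv⟩ := M.exists_isHighest rank
  have key : ∀ l ∈ M.dual.kInv, l v = 0 → l = 0 := by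
    intro l hl hlv
    obtain ⟨W, hW, -, hvW, hker⟩ := M.exists_stable_le_ker
      (A := {x | x ∈ osp n m ∧ ∃ i, x ∈ glGr n m i})
      (B := {x | ∃ i j : Idx n m, rank i ≤ rank j ∧ x = matUnit i j})
      (fun a ha => ha.2) (by rintro _ ⟨i, j, -, rfl⟩; exact ⟨_, matUnit_mem i j⟩)
      mem_span_osp_union_borel hv.par (by
        rintro _ ⟨i, j, hij, rfl⟩
        rcases hij.lt_or_eq with h | h
        · exact ⟨0, by rw [hv.raise i j h, zero_smul]⟩
        · obtain rfl := rank_injective h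
          exact ⟨_, hv.weight i⟩) l hlv
      (fun a ha u => M.apply_act_of_mem_kInv hl ha.1 u)
    have htop := hM.eq_top_of_mem hW hv.ne_zero hv.par hvW
    exact LinearMap.ext fun u => hker u (by rw [htop]; trivial)
  let E : M.dual.kInv →ₗ[ℂ] ℂ := Module.Dual.eval ℂ U v ∘ₗ M.dual.kInv.subtype
  have hE : Function.Injective E := by
    rw [injective_iff_map_eq_zero]
    intro l hl
    exact Subtype.ext (key l l.2 hl)
  have h := LinearMap.finrank_le_finrank_of_injective hE
  rwa [Module.finrank_self] at h

/-- An isomorphism of `U^θ` with `U^*` restricts to invariant vectors. -/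
theorem mem_dual_kInv_iff {M : GLModule n m U} (e : U ≃ₗ[ℂ] Module.Dual ℂ U)
    (he : ∀ x u, e (M.twist.act x u) = M.dual.act x (e u)) (u : U) :
    e u ∈ M.dual.kInv ↔ u ∈ M.kInv := by
  rw [mem_kInv_iff, mem_kInv_iff]
  refine forall₂_congr fun x hx => ?_
  have hx' : theta x = x := hx
  rw [← he, twist_act, hx', LinearEquiv.map_eq_zero_iff]

theorem IsIrreducible.finrank_kInv_le_one [FiniteDimensional ℂ U] {M : GLModule n m U}
    (hM : M.IsIrreducible) : Module.finrank ℂ M.kInv ≤ 1 := by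
  obtain ⟨e, -, he⟩ := hM.twist_isIsomorphic_dual
  have h : M.dual.kInv.comap e.toLinearMap = M.kInv := by
    ext u
    exact mem_dual_kInv_iff e he u
  have h' : M.kInv.map e.toLinearMap = M.dual.kInv := by
    rw [← h, Submodule.map_comap_eq_of_surjective e.surjective]
  have h2 := hM.finrank_dual_kInv_le_one
  rw [← h'] at h2
  rwa [← LinearEquiv.finrank_map_eq e M.kInv]

/-! ### Transport of `O(n)`-invariance to the dual -/

theorem exp_neg_transpose_mem_orthogonalGroup {X : Matrix (Fin n) (Fin n) ℂ}
    (hX : NormedSpace.exp X ∈ Matrix.orthogonalGroup (Fin n) ℂ) :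
    NormedSpace.exp (-Xᵀ) ∈ Matrix.orthogonalGroup (Fin n) ℂ := by
  have h1 := (Matrix.mem_orthogonalGroup_iff (Fin n) ℂ).mp hX
  have h2 : NormedSpace.exp (-Xᵀ) = NormedSpace.exp X := by
    rw [Matrix.exp_neg, Matrix.exp_transpose]
    exact Matrix.inv_eq_left_inv h1
  rwa [h2]

/-- Under `e`, the action of X on U^* becomes that of θ(X) = -Xᵀ on U, and X ↦ -Xᵀ preserves the
condition exp(X) ∈ O(n). -/
theorem mem_dual_kInvO {M : GLModule n m U} (e : U ≃ₗ[ℂ] Module.Dual ℂ U)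
    (he : ∀ x u, e (M.twist.act x u) = M.dual.act x (e u)) {u : U} (hu : u ∈ M.kInvO) :
    e u ∈ M.dual.kInvO := by
  refine ⟨(mem_dual_kInv_iff e he u).mpr hu.1, fun X hX f => ?_⟩
  have h := hu.2 (-Xᵀ) (exp_neg_transpose_mem_orthogonalGroup hX) (f ∘ₗ e.toLinearMap)
  have hpow : ∀ k : ℕ, (M.dual.act (Matrix.fromBlocks X 0 0 0) ^ k) (e u) =
      e ((M.act (Matrix.fromBlocks (-Xᵀ) 0 0 0) ^ k) u) := by
    intro k
    induction k with
    | zero => simp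
    | succ k ih =>
      rw [pow_succ', Module.End.mul_apply, ih, pow_succ', Module.End.mul_apply, ← he, twist_act,
        theta_fromBlocks]
      simp
  simp only [hpow]
  exact h

/-! ### Zonal spherical functions -/

theorem uact_ugι (M : GLModule n m U) (x : Gl n m) : M.uact (ugι x) = M.act x :=
  ugLift_ugι M.act M.act_sbracket x

theorem phi_apply (M : GLModule n m U) (u : U) (l : Module.Dual ℂ U) (w : Ug n m) :
    M.phi u l w = l (M.uact w u) := rfl

/-- Conjugation by the involution `par` implements the parity automorphism on U; this makes matrix
coefficients of parity eigenvectors eigenvectors of `ugPar`. -/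
theorem uact_ugPar (M : GLModule n m U) (w : Ug n m) :
    ∀ u, M.uact (ugPar w) u = M.par (M.uact w (M.par u)) := by
  induction w using ug_induction with
  | hone => intro u; simp [par_par_apply]
  | hsmul c w hw => intro u; simp [hw]
  | hadd a b ha hb => intro u; simp [ha, hb]
  | hmul i x hx w hw =>
    intro u
    rw [map_mul, map_mul, map_mul, Module.End.mul_apply, Module.End.mul_apply, hw, uact_ugι,
      M.par_act hx]
    rcases zmod_two_cases i with rfl | rfl
    · rw [ugPar_ugι_even hx, uact_ugι, sgn_zero_left, one_smul]
    · rw [ugPar_ugι_odd hx, map_neg, uact_ugι, sgn_one_one, neg_one_smul, LinearMap.neg_apply]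

theorem IsIrreducible.exists_uact_eq_smul [FiniteDimensional ℂ U] {M : GLModule n m U}
    (hM : M.IsIrreducible) {z : Ug n m} (hz : z ∈ Subalgebra.center ℂ (Ug n m)) :
    ∃ c : ℂ, ∀ u, M.uact z u = c • u := by
  refine hM.exists_eq_smul (M.uact z) fun x u => ?_
  have h := congrArg M.uact (Subalgebra.mem_center_iff.mp hz (ugι x))
  rw [map_mul, map_mul, uact_ugι] at h
  exact (LinearMap.congr_fun h u).symm

theorem isZonal_phi (M : GLModule n m U) {u : U} {l : Module.Dual ℂ U} (hu : u ∈ M.kInv)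
    (hl : l ∈ M.dual.kInv) : IsZonal (M.phi u l) := by
  intro x hx w
  constructor
  · rw [phi_apply, map_mul, uact_ugι, Module.End.mul_apply]
    exact M.apply_act_of_mem_kInv hl hx _
  · rw [phi_apply, map_mul, uact_ugι, Module.End.mul_apply, hu x hx, map_zero, map_zero]

/-- The orbit U(𝔤)u is a submodule containing the homogeneous vector u, so it is U, and a functional
vanishing on it is zero. -/
theorem IsIrreducible.phi_ne_zero {M : GLModule n m U} (hM : M.IsIrreducible) {u : U}
    {l : Module.Dual ℂ U} (hu0 : u ≠ 0) (hl0 : l ≠ 0) {ε : ℂ} (hu : M.par u = ε • u) :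
    M.phi u l ≠ 0 := by
  intro h
  have htop : LinearMap.range (LinearMap.applyₗ u ∘ₗ M.uact.toLinearMap) = ⊤ := by
    refine hM.eq_top_of_mem ?_ hu0 hu ⟨1, by simp⟩
    rintro x _ ⟨w, rfl⟩
    exact ⟨ugι x * w, by simp [uact_ugι]⟩
  refine hl0 (LinearMap.ext fun v => ?_)
  have hv : v ∈ LinearMap.range (LinearMap.applyₗ u ∘ₗ M.uact.toLinearMap) := by
    rw [htop]; trivial
  obtain ⟨w, rfl⟩ := hv
  exact LinearMap.congr_fun h w

theorem exists_smul_eq_of_finrank_le_one {V : Type*} [AddCommGroup V] [Module ℂ V]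
    [FiniteDimensional ℂ V] {W : Submodule ℂ V} (hW : Module.finrank ℂ W ≤ 1) {v w : V}
    (hv : v ∈ W) (hv0 : v ≠ 0) (hw : w ∈ W) : ∃ c : ℂ, w = c • v := by
  have hv0' : (⟨v, hv⟩ : W) ≠ 0 := fun h => hv0 (congrArg Subtype.val h)
  have : Nontrivial W := ⟨_, _, hv0'⟩
  have h1 : Module.finrank ℂ W = 1 := le_antisymm hW Module.finrank_pos
  obtain ⟨c, hc⟩ := (finrank_eq_one_iff_of_nonzero' _ hv0').mp h1 ⟨w, hw⟩
  exact ⟨c, (congrArg Subtype.val hc).symm⟩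

/-- By dimension ≤ 1, u and l are automatically parity eigenvectors. Each term of `dualAct z` is
then a scalar from the parity of φ times a scalar from Schur's lemma. -/
theorem IsIrreducible.isZonalSpherical_phi [FiniteDimensional ℂ U] {M : GLModule n m U}
    (hM : M.IsIrreducible) {u : U} {l : Module.Dual ℂ U} (hu : u ∈ M.kInv)
    (hl : l ∈ M.dual.kInv) (hu0 : u ≠ 0) (hl0 : l ≠ 0) : IsZonalSpherical (M.phi u l) := by
  obtain ⟨ε, hε⟩ := exists_smul_eq_of_finrank_le_one hM.finrank_kInv_le_one hu hu0
    (M.par_mem_kInv hu)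
  obtain ⟨δ, hδ⟩ := exists_smul_eq_of_finrank_le_one hM.finrank_dual_kInv_le_one hl hl0
    (M.dual.par_mem_kInv hl)
  rw [M.dual_par] at hδ
  refine ⟨M.isZonal_phi hu hl, hM.phi_ne_zero hu0 hl0 hε, fun z hz => ?_⟩
  have hpar : M.phi u l ∘ₗ ugPar.toLinearMap = (δ * ε) • M.phi u l := by
    refine LinearMap.ext fun w => ?_
    have h := LinearMap.congr_fun hδ (M.uact w (M.par u))
    rw [LinearMap.comp_apply, LinearMap.smul_apply] at h
    change l (M.uact (ugPar w) u) = (δ * ε) • l (M.uact w u)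
    rw [M.uact_ugPar, h, hε, map_smul, map_smul, smul_smul]
  have hcomp : ∀ j, ∃ a : ℂ, dualComp j (M.phi u l) = a • M.phi u l := by
    intro j
    refine ⟨2⁻¹ * (1 + sgn j 1 * (δ * ε)), ?_⟩
    rw [dualComp, hpar]
    module
  -- `ugT` and `ugComp` keep z central, so the element multiplied on the left acts on U by a scalar
  -- that comes out of l.
  have hmul : ∀ i, ∃ b : ℂ,
      M.phi u l ∘ₗ LinearMap.mulLeft ℂ (ugT (ugComp i z)) = b • M.phi u l := by
    intro i
    obtain ⟨b, hb⟩ := hM.exists_uact_eq_smul (ugT_mem_center (ugComp_mem_center i hz))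
    refine ⟨b, LinearMap.ext fun w => ?_⟩
    change l (M.uact (_ * w) u) = b • l (M.uact w u)
    rw [map_mul, Module.End.mul_apply, hb, map_smul]
  choose a ha using hcomp
  choose b hb using hmul
  refine ⟨∑ i : ZMod 2, ∑ j : ZMod 2, sgn i j * (a j * b i), ?_⟩
  rw [dualAct, Finset.sum_smul]
  refine Finset.sum_congr rfl fun i _ => ?_
  rw [Finset.sum_smul]
  refine Finset.sum_congr rfl fun j _ => ?_
  rw [ha, LinearMap.smul_comp, hb, smul_smul, smul_smul, mul_assoc]

theorem IsIrreducible.zonalSpace_eq_span [FiniteDimensional ℂ U] {M : GLModule n m U}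
    (hM : M.IsIrreducible) {A : Submodule ℂ U} {B : Submodule ℂ (Module.Dual ℂ U)}
    (hA : A ≤ M.kInv) (hB : B ≤ M.dual.kInv) {u : U} {l : Module.Dual ℂ U} (hu : u ∈ A)
    (hl : l ∈ B) (hu0 : u ≠ 0) (hl0 : l ≠ 0) :
    M.zonalSpace A B = Submodule.span ℂ {M.phi u l} := by
  refine le_antisymm (Submodule.span_le.mpr ?_)
    (Submodule.span_mono (Set.singleton_subset_iff.mpr ⟨u, hu, l, hl, rfl⟩))
  rintro _ ⟨u', hu', l', hl', rfl⟩
  obtain ⟨c, rfl⟩ := exists_smul_eq_of_finrank_le_one hM.finrank_kInv_le_one (hA hu) hu0 (hA hu')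
  obtain ⟨d, rfl⟩ := exists_smul_eq_of_finrank_le_one hM.finrank_dual_kInv_le_one (hB hl) hl0
    (hB hl')
  refine Submodule.mem_span_singleton.mpr ⟨d * c, LinearMap.ext fun w => ?_⟩
  change (d * c) • l (M.uact w u) = (d • l) (M.uact w (c • u))
  rw [map_smul, map_smul, LinearMap.smul_apply, smul_smul, mul_comm]

/-- Stated for arbitrary nonzero subspaces of invariants, so that invariance under 𝔨 alone and under
𝔨 together with `O(n)` are handled at once. -/
theorem IsIrreducible.zonalSpace_spherical [FiniteDimensional ℂ U] {M : GLModule n m U}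
    (hM : M.IsIrreducible) {A : Submodule ℂ U} {B : Submodule ℂ (Module.Dual ℂ U)}
    (hA : A ≤ M.kInv) (hB : B ≤ M.dual.kInv) (hA0 : A ≠ ⊥) (hB0 : B ≠ ⊥) :
    Module.finrank ℂ (M.zonalSpace A B) = 1 ∧
      (∃ f, IsZonalSpherical f ∧ M.zonalSpace A B = Submodule.span ℂ {f}) ∧
      ∀ u ∈ A, ∀ l ∈ B, u ≠ 0 → l ≠ 0 → IsZonalSpherical (M.phi u l) := by
  obtain ⟨u, hu, hu0⟩ := Submodule.exists_mem_ne_zero_of_ne_bot hA0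
  obtain ⟨l, hl, hl0⟩ := Submodule.exists_mem_ne_zero_of_ne_bot hB0
  have hspan := hM.zonalSpace_eq_span hA hB hu hl hu0 hl0
  have hφ := hM.isZonalSpherical_phi (hA hu) (hB hl) hu0 hl0
  refine ⟨?_, ⟨_, hφ, hspan⟩, fun u' hu' l' hl' h1 h2 =>
    hM.isZonalSpherical_phi (hA hu') (hB hl') h1 h2⟩
  rw [hspan]
  exact finrank_span_singleton hφ.2.1

end GLModule

end GLOsp

end

theorem mainTheorem5 (n m : ℕ) {U : Type*} [AddCommGroup U] [Module ℂ U] [FiniteDimensional ℂ U]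
    (M : GLOsp.GLModule n m U) (hM : M.IsIrreducible) :
    -- `U^θ ≅ U^*`
    M.twist.IsIsomorphic M.dual ∧
    -- `dim U^k ≤ 1`
    Module.finrank ℂ M.kInv ≤ 1 ∧
    -- spherical modules, with `U^k` the vectors killed by `osp(n,2m)`
    (M.kInv ≠ ⊥ →
      Module.finrank ℂ (M.zonalSpace M.kInv M.dual.kInv) = 1 ∧
      (∃ f, GLOsp.IsZonalSpherical f ∧ M.zonalSpace M.kInv M.dual.kInv = Submodule.span ℂ {f}) ∧
      ∀ u ∈ M.kInv, ∀ l ∈ M.dual.kInv, u ≠ 0 → l ≠ 0 → GLOsp.IsZonalSpherical (M.phi u l)) ∧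
    -- spherical modules, with `U^k` the vectors killed by `osp(n,2m)` and fixed by `O(n)`
    (M.kInvO ≠ ⊥ →
      Module.finrank ℂ (M.zonalSpace M.kInvO M.dual.kInvO) = 1 ∧
      (∃ f, GLOsp.IsZonalSpherical f ∧ M.zonalSpace M.kInvO M.dual.kInvO = Submodule.span ℂ {f}) ∧
      ∀ u ∈ M.kInvO, ∀ l ∈ M.dual.kInvO, u ≠ 0 → l ≠ 0 →
        GLOsp.IsZonalSpherical (M.phi u l)) := by
  obtain ⟨e, hgr, he⟩ := hM.twist_isIsomorphic_dual
  refine ⟨⟨e, hgr, he⟩, hM.finrank_kInv_le_one, fun h => ?_, fun h => ?_⟩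
  -- Nonzero invariant functionals come from nonzero invariant vectors through the isomorphism `e`.
  · refine hM.zonalSpace_spherical le_rfl le_rfl h ?_
    obtain ⟨u, hu, hu0⟩ := Submodule.exists_mem_ne_zero_of_ne_bot h
    exact Submodule.ne_bot_iff _ |>.mpr
      ⟨e u, (GLOsp.GLModule.mem_dual_kInv_iff e he u).mpr hu, by simpa using hu0⟩
  · refine hM.zonalSpace_spherical (fun u hu => hu.1) (fun l hl => hl.1) h ?_
    obtain ⟨u, hu, hu0⟩ := Submodule.exists_mem_ne_zero_of_ne_bot h
    exact Submodule.ne_bot_iff _ |>.mpr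
      ⟨e u, GLOsp.GLModule.mem_dual_kInvO e he hu, by simpa using hu0⟩
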